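/- Let $\mathcal H_1,\mathcal H_2$ be separable complex Hilbert spaces, $U$ and $V$ unitary operators on $\mathcal H_1$ and $\mathcal H_2$, and let $a\in\mathcal H_1$, $b\in\mathcal H_2$ be such that $\{U^na\}_{n\in\mathbb Z}$ and $\{V^mb\}_{m\in\mathbb Z}$ are Riesz sequences (Riesz bases for their closed linear spans). In the Hilbert tensor product $\mathcal H_1\otimes\mathcal H_2$ put $$\mathcal A_{a,b}:=\overline{\operatorname{span}}\{U^na\otimes V^mb\}_{n,m\in\mathbb Z}.$$ Let $r,\bar r\ge 1$ be integers, let $h_{11},\dots,h_{r1}\in\mathcal H_1$ and $h_{12},\dots,h_{\bar r2}\in\mathcal H_2$, and for $x\in\mathcal A_{a,b}$, $1\le j\le r$, $1\le j'\le\bar r$, $n,m\in\mathbb Z$ define the samples $$\mathcal L_{jj'}x(rn,\bar rm):=\big\langle x,\;U^{rn}h_{j1}\otimes V^{\bar rm}h_{j'2}\big\rangle .$$ Consider the $1$-periodic functions, in $L^2(0,1)$ on a period, $$g_{j1}(x):=\sum_{k\in\mathbb Z}\langle a,U^kh_{j1}\rangle\,e^{2\pi ikx},\qquad g_{j'2}(x):=\sum_{k\in\mathbb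 Z}\langle b,V^kh_{j'2}\rangle\,e^{2\pi ikx},$$ and assume that they all belong to $L^\infty(0,1)$. Let $\mathbf G_1(x)=\big(g_{j1}(x+\tfrac{k-1}{r})\big)_{j,k=1}^{r}$, $\mathbf G_2(x)=\big(g_{j'2}(x+\tfrac{k-1}{\bar r})\big)_{j',k=1}^{\bar r}$, and $$\alpha_{\mathbf G_1}:=\operatorname*{ess\,inf}_{x\in(0,1/r)}\lambda_{\min}[\mathbf G_1^*(x)\mathbf G_1(x)],\qquad \alpha_{\mathbf G_2}:=\operatorname*{ess\,inf}_{x\in(0,1/\bar r)}\lambda_{\min}[\mathbf G_2^*(x)\mathbf G_2(x)],$$ where $\lambda_{\min}$ denotes the smallest eigenvalue. Then the following statements are equivalent: 1. $\alpha_{\mathbf G_1}>0$ and $\alpha_{\mathbf G_2}>0$. 2. There exist $r\bar r$ unique elements $c_j\otimes d_{j'}$ of $\mathcal A_{a,b}$, $1\le j\le r$, $1\le j'\le\bar r$ (with $c_j\in\mathcal H_1$, $d_{j'}\in\mathcal H_2$; uniqueness refers to the tensors $c_j\otimes d_{j'}$), such that the family $\big\{(U^{rn}\otimes V^{\bar rm})(c_j\otimes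 d_{j'})\big\}_{j,j',n,m}$, with $n,m\in\mathbb Z$, is a Riesz basis for $\mathcal A_{a,b}$ and every $x\in\mathcal A_{a,b}$ has the expansion $$x=\sum_{j=1}^{r}\sum_{j'=1}^{\bar r}\sum_{n\in\mathbb Z}\sum_{m\in\mathbb Z}\mathcal L_{jj'}x(rn,\bar rm)\,(U^{rn}\otimes V^{\bar rm})(c_j\otimes d_{j'})\quad\text{in }\mathcal H_1\otimes\mathcal H_2 .$$ Moreover, whenever these conditions hold, the elements $c_j\otimes d_{j'}$ in (2) satisfy the interpolation property $$\mathcal L_{kk'}(c_j\otimes d_{j'})(rn,\bar rm)=\delta_{j,k}\,\delta_{j',k'}\,\delta_{n,0}\,\delta_{m,0}$$ for all $n,m\in\mathbb Z$, $1\le j,k\le r$ and $1\le j',k'\le\bar r$. -/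

import Mathlib

open MeasureTheory AddCircle
open scoped ENNReal TensorProduct ComplexConjugate

noncomputable section

namespace UVSampling

/-- The family `x` is a Riesz basis for the subspace `M`: it is the image of an orthonormal basis
(the canonical basis of `ℓ²(ι)`) under a bounded, boundedly invertible operator onto `M`. -/
def IsRieszBasis {ι E : Type*} [DecidableEq ι] [NormedAddCommGroup E] [InnerProductSpace ℂ E]
    (x : ι → E) (M : Submodule ℂ E) : Prop :=
  ∃ T : lp (fun _ : ι => ℂ) 2 ≃L[ℂ] M, ∀ i, (T (lp.single 2 i (1 : ℂ)) : E) = x i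

/-- A Riesz sequence is a Riesz basis for its closed linear span. -/
def IsRieszSequence {ι E : Type*} [DecidableEq ι] [NormedAddCommGroup E] [InnerProductSpace ℂ E]
    (x : ι → E) : Prop :=
  IsRieszBasis x (Submodule.span ℂ (Set.range x)).topologicalClosure

/-- The Hilbert space tensor product: the completion of the algebraic tensor product with respect
to the inner product determined by `⟪u ⊗ v, u' ⊗ v'⟫ = ⟪u, u'⟫ ⟪v, v'⟫`. -/
abbrev HTensor (H₁ H₂ : Type*) [NormedAddCommGroup H₁] [InnerProductSpace ℂ H₁]
    [NormedAddCommGroup H₂] [InnerProductSpace ℂ H₂] : Type _ :=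
  UniformSpace.Completion (H₁ ⊗[ℂ] H₂)

section

variable {H₁ H₂ : Type*} [NormedAddCommGroup H₁] [InnerProductSpace ℂ H₁]
  [NormedAddCommGroup H₂] [InnerProductSpace ℂ H₂]

/-- The elementary tensor `u ⊗ v` in the Hilbert space tensor product. -/
def tens (u : H₁) (v : H₂) : HTensor H₁ H₂ :=
  ((u ⊗ₜ[ℂ] v : H₁ ⊗[ℂ] H₂) : UniformSpace.Completion (H₁ ⊗[ℂ] H₂))

/-- The operator `S ⊗ T` on the Hilbert space tensor product, for unitary operators `S`, `T`. -/
def tensOp (S : H₁ ≃ₗᵢ[ℂ] H₁) (T : H₂ ≃ₗᵢ[ℂ] H₂) : HTensor H₁ H₂ →L[ℂ] HTensor H₁ H₂ :=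
  (TensorProduct.congrIsometry S T).toLinearIsometry.toContinuousLinearMap.completion

theorem tensOp_tens (S : H₁ ≃ₗᵢ[ℂ] H₁) (T : H₂ ≃ₗᵢ[ℂ] H₂) (u : H₁) (v : H₂) :
    tensOp S T (tens u v) = tens (S u) (T v) := by
  simp [tensOp, tens]

theorem inner_tens (u u' : H₁) (v v' : H₂) :
    inner ℂ (tens u v) (tens u' v') = inner ℂ u u' * inner ℂ v v' := by
  simp [tens]

/-- The closed subspace `A_{a,b}` spanned by the vectors `Uⁿ a ⊗ Vᵐ b`, `n, m ∈ ℤ`. -/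
def shiftSpace (U : H₁ ≃ₗᵢ[ℂ] H₁) (V : H₂ ≃ₗᵢ[ℂ] H₂) (a : H₁) (b : H₂) :
    Submodule ℂ (HTensor H₁ H₂) :=
  (Submodule.span ℂ
    (Set.range fun p : ℤ × ℤ => tens ((U ^ p.1) a) ((V ^ p.2) b))).topologicalClosure

/-- For `h = h₁ ⊗ h₂`, the sample `ℒ x (k, l) = ⟨x, Uᵏ h₁ ⊗ Vˡ h₂⟩`. Here `⟨·, ·⟩` is
linear in its first entry, whereas Mathlib's `inner` is linear in its second one. -/
def sample (U : H₁ ≃ₗᵢ[ℂ] H₁) (V : H₂ ≃ₗᵢ[ℂ] H₂) (h₁ : H₁) (h₂ : H₂)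
    (x : HTensor H₁ H₂) (k l : ℤ) : ℂ :=
  inner ℂ (tens ((U ^ k) h₁) ((V ^ l) h₂)) x

/-- The function `g(x) = ∑ₖ ⟨a, Uᵏ h⟩ e^{2πikx}`, the series converging in `L²` of the circle `ℝ/ℤ`
with its normalized Haar measure, that is, in `L²(0,1)` with `1`-periodic extension.
The convergence is `hasSum_genFun`. -/
def genFun (U : H₁ ≃ₗᵢ[ℂ] H₁) (a h : H₁) :
    Lp ℂ 2 (haarAddCircle : Measure (AddCircle (1 : ℝ))) :=
  ∑' k : ℤ, (inner ℂ ((U ^ k) h) a : ℂ) • fourierLp 2 k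

theorem hasSum_genFun [CompleteSpace H₁] (U : H₁ ≃ₗᵢ[ℂ] H₁) (a h : H₁)
    (ha : IsRieszSequence fun n : ℤ => (U ^ n) a) :
    HasSum (fun k : ℤ => (inner ℂ ((U ^ k) h) a : ℂ) •
      (fourierLp 2 k : Lp ℂ 2 (haarAddCircle : Measure (AddCircle (1 : ℝ))))) (genFun U a h) := by
  obtain ⟨T, hT⟩ := ha
  let A : lp (fun _ : ℤ => ℂ) 2 →L[ℂ] H₁ :=
    (Submodule.subtypeL _) ∘L T.toContinuousLinearMap
  let v : lp (fun _ : ℤ => ℂ) 2 := ContinuousLinearMap.adjoint A h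
  have key : ∀ k : ℤ, (inner ℂ ((U ^ k) h) a : ℂ) = conj (v (-k)) := by
    intro k
    have h1 : (inner ℂ ((U ^ k) h) a : ℂ) = inner ℂ h ((U ^ (-k)) a) := by
      have h2 := (U ^ k).inner_map_map h ((U ^ (-k)) a)
      have h4 : (U ^ k) ((U ^ (-k)) a) = a := by
        change (U ^ k * U ^ (-k)) a = a
        rw [← zpow_add, add_neg_cancel, zpow_zero]
        rfl
      rw [← h2, h4]
    have h3 : A (lp.single 2 (-k) (1 : ℂ)) = (U ^ (-k)) a := hT (-k)
    rw [h1, ← h3, ← ContinuousLinearMap.adjoint_inner_left, lp.inner_single_right]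
    simp [v]
  have hmem : Memℓp (fun k : ℤ => (inner ℂ ((U ^ k) h) a : ℂ)) 2 := by
    rw [memℓp_gen_iff (by norm_num)]
    have hv := (memℓp_gen_iff (by norm_num)).1 (lp.memℓp v)
    have := (Equiv.neg ℤ).summable_iff.2 hv
    refine this.congr fun k => ?_
    simp [key]
  have hs := (fourierBasis (T := (1 : ℝ))).hasSum_repr_symm ⟨_, hmem⟩
  rw [coe_fourierBasis] at hs
  exact hs.summable.hasSum

end

/-- The `s × r` matrix `G(x) = (g_j(x + k / r))`, `k = 0, …, r - 1`, for functions on `ℝ/ℤ`. -/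
def periodMatrix {s : ℕ} (r : ℕ) (g : Fin s → AddCircle (1 : ℝ) → ℂ) (x : ℝ) :
    Matrix (Fin s) (Fin r) ℂ :=
  Matrix.of fun j k => g j ((x + (k : ℕ) / (r : ℝ) : ℝ) : AddCircle (1 : ℝ))

/-- The smallest eigenvalue of the positive semidefinite matrix `G* G`. -/
def lambdaMin {s r : ℕ} (G : Matrix (Fin s) (Fin r) ℂ) : ℝ :=
  ⨅ i, (Matrix.isHermitian_conjTranspose_mul_self G).eigenvalues i

/-- The constant `α_G = ess inf_{x ∈ (0, 1/r)} λ_min(G*(x) G(x))`, with values in `[0, ∞]`. -/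
def alphaConst {s : ℕ} (r : ℕ) (g : Fin s → AddCircle (1 : ℝ) → ℂ) : ℝ≥0∞ :=
  essInf (fun x : ℝ => ENNReal.ofReal (lambdaMin (periodMatrix r g x)))
    (volume.restrict (Set.Ioo (0 : ℝ) (1 / r)))

section

variable {H₁ H₂ : Type*} [NormedAddCommGroup H₁] [InnerProductSpace ℂ H₁]
  [NormedAddCommGroup H₂] [InnerProductSpace ℂ H₂]

/-- The vectors `C j j'` are elementary tensors in `A_{a,b}` whose shifts
`(U^{rn} ⊗ V^{r'm}) (C j j')` form a Riesz basis for `A_{a,b}`, and every `x ∈ A_{a,b}` has the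
expansion `x = ∑ ℒ_{jj'} x (rn, r'm) (U^{rn} ⊗ V^{r'm}) (C j j')`. -/
structure IsRieszSampling (U : H₁ ≃ₗᵢ[ℂ] H₁) (V : H₂ ≃ₗᵢ[ℂ] H₂) (a : H₁) (b : H₂)
    {s s' : ℕ} (r r' : ℕ) (h₁ : Fin s → H₁) (h₂ : Fin s' → H₂)
    (C : Fin s → Fin s' → HTensor H₁ H₂) : Prop where
  elementary : ∃ (c : Fin s → H₁) (d : Fin s' → H₂), ∀ j j', C j j' = tens (c j) (d j')
  mem : ∀ j j', C j j' ∈ shiftSpace U V a b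
  rieszBasis : IsRieszBasis
    (fun i : (Fin s × Fin s') × (ℤ × ℤ) =>
      tensOp (U ^ ((r : ℤ) * i.2.1)) (V ^ ((r' : ℤ) * i.2.2)) (C i.1.1 i.1.2))
    (shiftSpace U V a b)
  expansion : ∀ x ∈ shiftSpace U V a b, HasSum
    (fun i : (Fin s × Fin s') × (ℤ × ℤ) =>
      sample U V (h₁ i.1.1) (h₂ i.1.2) x ((r : ℤ) * i.2.1) ((r' : ℤ) * i.2.2) •
        tensOp (U ^ ((r : ℤ) * i.2.1)) (V ^ ((r' : ℤ) * i.2.2)) (C i.1.1 i.1.2)) x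

end

end UVSampling

end

open UVSampling

/-! The problem splits into two one-variable problems. In one variable, the isomorphism `Q` with
e^{2πinx} ↦ Uⁿa identifies L²(ℝ/ℤ) with the closed span of the orbit of a, and the sample ⟨QF,
U^{rn}h_j⟩ becomes ⟨F, conj g_j · e^{2πirnx}⟩ (`inner_zpow_equiv_eq`). Everything therefore depends
on the family `modulates` of the functions conj g_j · e^{2πirnx}.

A combination of this family is ∑_j conj g_j · φ_j(r·). Since φ_j(r·) is 1/r-periodic, its squared
norm is 1/r times the integral of ‖G(x)*φ(rx)‖² (`norm_sq_sum_conjMulDilation`). The lower Riesz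
inequality is thus a uniform bound GG* ≥ c a.e., and as G is square this says α_G > 0
(`alphaConst_pos_iff`, `alphaConst_pos_of_isLowerRieszWith`). The same bound makes G(x) invertible,
which gives completeness (`closure_span_modulates`).

From (1) to (2): each variable has a dual Riesz basis, biorthogonality forces it to be a family of
U^{rn}-shifts, and the tensor product of the two dual bases is the required one. From (2) to (1):
expanding c_j ⊗ d_{j'} itself and comparing coefficients yields the interpolation property, hence
also uniqueness. Freezing one index leaves a Bessel family biorthogonal to the U^{rn}h_j in the
other variable, and Cauchy–Schwarz turns this into the lower Riesz inequality for `modulates`. -/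

noncomputable section

namespace UVSampling

/-! ### Riesz bases and the two Riesz inequalities -/

section Riesz

variable {ι E : Type*} [NormedAddCommGroup E] [InnerProductSpace ℂ E]

/-- The Bessel inequality for finite linear combinations of the family `x`. -/
def IsBesselWith (C : ℝ) (x : ι → E) : Prop :=
  ∀ (s : Finset ι) (α : ι → ℂ), ‖∑ i ∈ s, α i • x i‖ ^ 2 ≤ C * ∑ i ∈ s, ‖α i‖ ^ 2

/-- The lower Riesz inequality for finite linear combinations of the family `x`. -/
def IsLowerRieszWith (c : ℝ) (x : ι → E) : Prop :=
  ∀ (s : Finset ι) (α : ι → ℂ), c * ∑ i ∈ s, ‖α i‖ ^ 2 ≤ ‖∑ i ∈ s, α i • x i‖ ^ 2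

theorem IsBesselWith.mono {C C' : ℝ} {x : ι → E} (h : IsBesselWith C x) (hC : C ≤ C') :
    IsBesselWith C' x := fun s α => (h s α).trans <|
  mul_le_mul_of_nonneg_right hC (Finset.sum_nonneg fun _ _ => sq_nonneg _)

theorem lp_norm_sq_sum_single [DecidableEq ι] (s : Finset ι) (α : ι → ℂ) :
    ‖∑ i ∈ s, lp.single (E := fun _ : ι => ℂ) 2 i (α i)‖ ^ 2 = ∑ i ∈ s, ‖α i‖ ^ 2 := by
  have := lp.norm_sum_single (E := fun _ : ι => ℂ) (p := 2) (by norm_num) α s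
  simpa using this

theorem lp_hasSum_norm_sq (ξ : lp (fun _ : ι => ℂ) 2) :
    HasSum (fun i => ‖ξ i‖ ^ 2) (‖ξ‖ ^ 2) := by
  simpa using lp.hasSum_norm (p := 2) (by norm_num) ξ

theorem hasSum_of_map_single [DecidableEq ι] {x : ι → E} (T : lp (fun _ : ι => ℂ) 2 →L[ℂ] E)
    (hT : ∀ i, T (lp.single 2 i (1 : ℂ)) = x i) (ξ : lp (fun _ : ι => ℂ) 2) :
    HasSum (fun i => ξ i • x i) (T ξ) := by
  have h := (lp.hasSum_single (p := 2) (by norm_num) ξ).mapL T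
  convert h using 2 with i
  rw [← hT i, ← map_smul, ← lp.single_smul]
  simp

theorem IsBesselWith.exists_synthesis [DecidableEq ι] [CompleteSpace E] {C : ℝ} {x : ι → E}
    (hx : IsBesselWith C x) :
    ∃ T : lp (fun _ : ι => ℂ) 2 →L[ℂ] E, ∀ i, T (lp.single 2 i (1 : ℂ)) = x i := by
  -- Enlarging the constant to at least 1 allows division by it in the Cauchy criterion.
  have hx := hx.mono (le_max_left C 1)
  set D := max C 1
  have hD : 0 < D := lt_of_lt_of_le one_pos (le_max_right _ _)
  have hsum : ∀ ξ : lp (fun _ : ι => ℂ) 2, Summable fun i => ξ i • x i := by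
    intro ξ
    rw [summable_iff_vanishing_norm]
    intro ε hε
    obtain ⟨s, hs⟩ := summable_iff_vanishing_norm.1 (lp_hasSum_norm_sq ξ).summable (ε ^ 2 / D)
      (by positivity)
    refine ⟨s, fun t ht => ?_⟩
    have h1 := hs t ht
    rw [Real.norm_of_nonneg (Finset.sum_nonneg fun _ _ => sq_nonneg _), lt_div_iff₀ hD] at h1
    exact lt_of_pow_lt_pow_left₀ 2 hε.le (by linarith [hx t fun i => ξ i])
  let T₀ : lp (fun _ : ι => ℂ) 2 →ₗ[ℂ] E :=
    { toFun := fun ξ => ∑' i, ξ i • x i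
      map_add' := fun ξ η => by
        simp only [lp.coeFn_add, Pi.add_apply, add_smul]
        exact (hsum ξ).tsum_add (hsum η)
      map_smul' := fun c ξ => by
        simp only [lp.coeFn_smul, Pi.smul_apply, smul_assoc, RingHom.id_apply]
        exact (hsum ξ).tsum_const_smul c }
  have hT₀ : ∀ ξ, ‖T₀ ξ‖ ≤ √D * ‖ξ‖ := by
    intro ξ
    refine le_of_sq_le_sq ?_ (by positivity) 
    rw [mul_pow, Real.sq_sqrt hD.le]
    exact le_of_tendsto_of_tendsto' ((hsum ξ).hasSum.norm.pow 2)
      ((lp_hasSum_norm_sq ξ).mul_left D) fun s => by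
        simpa [Finset.mul_sum] using hx s fun i => ξ i
  refine ⟨T₀.mkContinuous _ hT₀, fun i => ?_⟩
  change ∑' k, (lp.single 2 i (1 : ℂ) : lp (fun _ : ι => ℂ) 2) k • x k = x i
  rw [tsum_eq_single i]
  · simp
  · intro k hk
    simp [hk]

theorem isBesselWith_of_map_single [DecidableEq ι] {x : ι → E} (T : lp (fun _ : ι => ℂ) 2 →L[ℂ] E)
    (hT : ∀ i, T (lp.single 2 i (1 : ℂ)) = x i) : IsBesselWith (‖T‖ ^ 2) x := by
  intro s α
  have h : ∑ i ∈ s, α i • x i = T (∑ i ∈ s, lp.single 2 i (α i)) := by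
    rw [map_sum]
    refine Finset.sum_congr rfl fun i _ => ?_
    rw [← hT i, ← map_smul, ← lp.single_smul]
    simp
  rw [h, ← lp_norm_sq_sum_single, ← mul_pow]
  gcongr
  exact T.le_opNorm _

theorem mem_closure_span_of_map_single [DecidableEq ι] {x : ι → E}
    (T : lp (fun _ : ι => ℂ) 2 →L[ℂ] E)
    (hT : ∀ i, T (lp.single 2 i (1 : ℂ)) = x i) (ξ : lp (fun _ : ι => ℂ) 2) :
    T ξ ∈ (Submodule.span ℂ (Set.range x)).topologicalClosure :=
  mem_closure_of_tendsto (hasSum_of_map_single T hT ξ) <| Filter.Eventually.of_forall fun _ =>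
    Submodule.sum_mem _ fun i _ => Submodule.smul_mem _ _ (Submodule.subset_span ⟨i, rfl⟩)

/-- A family satisfying both Riesz inequalities is a Riesz sequence. -/
theorem isRieszSequence_of_bounds [DecidableEq ι] [CompleteSpace E] {c C : ℝ} (hc : 0 < c)
    {x : ι → E} (hl : IsLowerRieszWith c x) (hu : IsBesselWith C x) : IsRieszSequence x := by
  obtain ⟨T, hT⟩ := hu.exists_synthesis
  have hlow : ∀ ξ, √c * ‖ξ‖ ≤ ‖T ξ‖ := by
    intro ξ
    refine le_of_sq_le_sq ?_ (by positivity)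
    rw [mul_pow, Real.sq_sqrt hc.le]
    exact le_of_tendsto_of_tendsto' ((lp_hasSum_norm_sq ξ).mul_left c)
      ((hasSum_of_map_single T hT ξ).norm.pow 2) fun s => by
        simpa [Finset.mul_sum] using hl s fun i => ξ i
  have hsc : 0 < √c := Real.sqrt_pos.2 hc
  have hanti : AntilipschitzWith (Real.toNNReal (√c)⁻¹) T := by
    refine AddMonoidHomClass.antilipschitz_of_bound T fun ξ => ?_
    rw [Real.coe_toNNReal _ (by positivity), inv_mul_eq_div, le_div_iff₀ hsc, mul_comm]
    exact hlow ξ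
  have hcl : IsClosed (Set.range T) := hanti.isClosed_range T.uniformContinuous
  have hM : T.range = (Submodule.span ℂ (Set.range x)).topologicalClosure := by
    apply le_antisymm
    · rintro _ ⟨ξ, rfl⟩
      exact mem_closure_span_of_map_single T hT ξ
    · refine Submodule.topologicalClosure_minimal _ (Submodule.span_le.2 ?_) hcl
      rintro _ ⟨i, rfl⟩
      exact ⟨_, hT i⟩
  unfold IsRieszSequence IsRieszBasis
  rw [← hM]
  exact ⟨T.equivRange hanti.injective hcl, fun i => hT i⟩

variable [DecidableEq ι] {x : ι → E} {M : Submodule ℂ E}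

theorem IsRieszBasis.mem (h : IsRieszBasis x M) (i : ι) : x i ∈ M := by
  obtain ⟨T, hT⟩ := h
  exact hT i ▸ (T _).2

theorem IsRieszBasis.isBesselWith (h : IsRieszBasis x M) : ∃ C, 0 < C ∧ IsBesselWith C x := by
  obtain ⟨T, hT⟩ := h
  exact ⟨_, by positivity, (isBesselWith_of_map_single (M.subtypeL ∘L T.toContinuousLinearMap)
    hT).mono (le_add_of_nonneg_right zero_le_one)⟩

theorem IsRieszBasis.isLowerRieszWith (h : IsRieszBasis x M) :
    ∃ c, 0 < c ∧ IsLowerRieszWith c x := by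
  obtain ⟨T, hT⟩ := h
  set S := T.symm.toContinuousLinearMap
  refine ⟨(‖S‖ ^ 2 + 1)⁻¹, by positivity, fun s α => ?_⟩
  have h : (T (∑ i ∈ s, lp.single 2 i (α i)) : E) = ∑ i ∈ s, α i • x i := by
    rw [map_sum, Submodule.coe_sum]
    refine Finset.sum_congr rfl fun i _ => ?_
    rw [← hT i, ← Submodule.coe_smul, ← map_smul, ← lp.single_smul]
    simp
  rw [inv_mul_le_iff₀ (by positivity), ← h, ← lp_norm_sq_sum_single]
  set ξ : lp (fun _ : ι => ℂ) 2 := ∑ i ∈ s, lp.single 2 i (α i)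
  have h2 : ‖ξ‖ ≤ ‖S‖ * ‖(T ξ : E)‖ := by
    simpa [S] using S.le_opNorm (T ξ)
  calc ‖ξ‖ ^ 2 ≤ (‖S‖ * ‖(T ξ : E)‖) ^ 2 := by gcongr
    _ ≤ _ := by rw [mul_pow]; gcongr; linarith

theorem IsRieszBasis.isClosed [CompleteSpace E] (h : IsRieszBasis x M) :
    IsClosed (M : Set E) := by
  obtain ⟨T, -⟩ := h
  have : CompleteSpace M := by
    rw [completeSpace_iff_isComplete_range (f := T.symm) T.symm.isUniformEmbedding.isUniformInducing,
      T.symm.surjective.range_eq]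
    exact completeSpace_iff_isComplete_univ.1 inferInstance
  exact (completeSpace_coe_iff_isComplete.1 this).isClosed

theorem IsRieszBasis.eq_closure [CompleteSpace E] (h : IsRieszBasis x M) :
    M = (Submodule.span ℂ (Set.range x)).topologicalClosure := by
  have hcl := h.isClosed
  refine le_antisymm ?_ (Submodule.topologicalClosure_minimal _ (Submodule.span_le.2 ?_) hcl)
  · obtain ⟨T, hT⟩ := h
    intro u hu
    have := mem_closure_span_of_map_single (M.subtypeL ∘L T.toContinuousLinearMap) hT
      (T.symm ⟨u, hu⟩)
    simpa using this
  · rintro _ ⟨i, rfl⟩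
    exact h.mem i

/-- The expansion of a vector along a Riesz basis, with coefficients from a biorthogonal family. -/
theorem IsRieszBasis.hasSum_inner (h : IsRieszBasis x M) {y : ι → E}
    (hxy : ∀ i k, inner ℂ (y i) (x k) = if i = k then (1 : ℂ) else 0) {u : E} (hu : u ∈ M) :
    HasSum (fun i => (inner ℂ (y i) u : ℂ) • x i) u := by
  obtain ⟨T, hT⟩ := h
  have h1 := hasSum_of_map_single (M.subtypeL ∘L T.toContinuousLinearMap) hT (T.symm ⟨u, hu⟩)
  have h2 : (M.subtypeL ∘L T.toContinuousLinearMap) (T.symm ⟨u, hu⟩) = u := by simp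
  rw [h2] at h1
  convert h1 using 3 with i
  have h3 := h1.mapL (innerSL ℂ (y i))
  simp only [innerSL_apply_apply, inner_smul_right, hxy, mul_ite, mul_one, mul_zero] at h3
  refine h3.unique ?_
  simpa using hasSum_single (f := fun k => if i = k then
    (T.symm ⟨u, hu⟩ : lp (fun _ : ι => ℂ) 2) k else 0) i fun k hk => by simp [hk.symm]

/-- The series already converges in `M`, so the inverse of `T` carries it to ℓ², where pairing with
unit vectors reads off the coefficients. This is the source of the interpolation property. -/
theorem IsRieszBasis.coeff_unique (h : IsRieszBasis x M) {α : ι → ℂ} {k : ι}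
    (hs : HasSum (fun i => α i • x i) (x k)) (i : ι) : α i = if i = k then 1 else 0 := by
  obtain ⟨T, hT⟩ := h
  have hx : ∀ i, x i = M.subtypeL (T (lp.single 2 i (1 : ℂ))) := fun i => (hT i).symm
  have h1 : HasSum (fun i => α i • T (lp.single 2 i (1 : ℂ))) (T (lp.single 2 k (1 : ℂ))) := by
    rw [hx k] at hs
    rw [← Topology.IsInducing.hasSum_iff (g := M.subtypeL) Topology.IsInducing.subtypeVal]
    convert hs using 2 with i
    simp [hx i]
  have h2 := h1.mapL T.symm.toContinuousLinearMap
  have h3 := h2.mapL (innerSL ℂ (lp.single (E := fun _ : ι => ℂ) 2 i (1 : ℂ)))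
  simp [lp.inner_single_left, Pi.single_apply] at h3
  refine (h3.unique ?_).symm
  simpa using hasSum_single (f := fun k => if i = k then α k else 0) i
    fun k hk => by simp [hk.symm]

end Riesz

/-! ### Tensor products of Riesz bases -/

section Tensor

variable {H₁ H₂ : Type*} [NormedAddCommGroup H₁] [InnerProductSpace ℂ H₁]
  [NormedAddCommGroup H₂] [InnerProductSpace ℂ H₂]

/-- The elementary tensor as a continuous bilinear map. -/
def tensL : H₁ →L[ℂ] H₂ →L[ℂ] HTensor H₁ H₂ :=
  (ContinuousLinearMap.compL ℂ H₂ (H₁ ⊗[ℂ] H₂) (HTensor H₁ H₂)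
    UniformSpace.Completion.toComplL) ∘L TensorProduct.mkL ℂ H₁ H₂

theorem tensL_apply (u : H₁) (v : H₂) : tensL u v = tens u v := rfl

theorem norm_sq_sum_tens_of_orthonormal {n : ℕ} {f : Fin n → H₁} (hf : Orthonormal ℂ f)
    (v : Fin n → H₂) : ‖∑ l, tens (f l) (v l)‖ ^ 2 = ∑ l, ‖v l‖ ^ 2 := by
  have h : (inner ℂ (∑ l, tens (f l) (v l)) (∑ l, tens (f l) (v l)) : ℂ) =
      ∑ l, (inner ℂ (v l) (v l) : ℂ) := by
    rw [sum_inner]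
    refine Finset.sum_congr rfl fun l _ => ?_
    rw [inner_sum, Finset.sum_eq_single l]
    · rw [inner_tens, orthonormal_iff_ite.1 hf]; simp
    · intro k _ hk
      rw [inner_tens, orthonormal_iff_ite.1 hf]; simp [hk.symm]
    · simp
  simp only [inner_self_eq_norm_sq_to_K] at h
  exact_mod_cast h

theorem exists_orthonormal_expansion {κ : Type*} (t : Finset κ) (w : κ → H₁) :
    ∃ (n : ℕ) (f : Fin n → H₁), Orthonormal ℂ f ∧
      ∀ k ∈ t, w k = ∑ l, (inner ℂ (f l) (w k) : ℂ) • f l ∧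
        ‖w k‖ ^ 2 = ∑ l, ‖(inner ℂ (f l) (w k) : ℂ)‖ ^ 2 := by
  let S : Submodule ℂ H₁ := Submodule.span ℂ (w '' t)
  have : FiniteDimensional ℂ S := FiniteDimensional.span_of_finite ℂ (t.finite_toSet.image w)
  let e := stdOrthonormalBasis ℂ S
  refine ⟨_, fun l => (e l : H₁), e.orthonormal.comp_linearIsometry S.subtypeₗᵢ, ?_⟩
  intro k hk
  let z : S := ⟨w k, Submodule.subset_span ⟨k, hk, rfl⟩⟩
  constructor
  · have := congrArg S.subtype (e.sum_repr' z)
    simpa [z] using this.symm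
  · exact (e.sum_sq_norm_inner_right z).symm

theorem sum_tens_eq {κ : Type*} {t : Finset κ} {w : κ → H₁} {n : ℕ} {f : Fin n → H₁}
    (h : ∀ k ∈ t, w k = ∑ l, (inner ℂ (f l) (w k) : ℂ) • f l) (y : κ → H₂) :
    ∑ k ∈ t, tens (w k) (y k) =
      ∑ l, tens (f l) (∑ k ∈ t, (inner ℂ (f l) (w k) : ℂ) • y k) := by
  simp only [← tensL_apply, map_sum]
  rw [Finset.sum_comm]
  refine Finset.sum_congr rfl fun k hk => ?_
  conv_lhs => rw [h k hk]
  simp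

/-- Expanding the `w k` in an orthonormal basis (f_l) of their span splits the sum into orthogonal
pieces f_l ⊗ v_l, where v_l is a scalar combination of the `y k`. The scalar inequality applies to
each piece, so it persists with vector coefficients. -/
theorem IsBesselWith.norm_sq_sum_tens_le {κ : Type*} {C : ℝ} {y : κ → H₂} (hy : IsBesselWith C y)
    (t : Finset κ) (w : κ → H₁) :
    ‖∑ k ∈ t, tens (w k) (y k)‖ ^ 2 ≤ C * ∑ k ∈ t, ‖w k‖ ^ 2 := by
  obtain ⟨n, f, hf, hw⟩ := exists_orthonormal_expansion t w
  rw [sum_tens_eq (fun k hk => (hw k hk).1), norm_sq_sum_tens_of_orthonormal hf,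
    Finset.sum_congr rfl fun k hk => (hw k hk).2, Finset.sum_comm, Finset.mul_sum]
  exact Finset.sum_le_sum fun l _ => hy t _

theorem IsLowerRieszWith.le_norm_sq_sum_tens {κ : Type*} {c : ℝ} {y : κ → H₂}
    (hy : IsLowerRieszWith c y) (t : Finset κ) (w : κ → H₁) :
    c * ∑ k ∈ t, ‖w k‖ ^ 2 ≤ ‖∑ k ∈ t, tens (w k) (y k)‖ ^ 2 := by
  obtain ⟨n, f, hf, hw⟩ := exists_orthonormal_expansion t w
  rw [sum_tens_eq (fun k hk => (hw k hk).1), norm_sq_sum_tens_of_orthonormal hf,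
    Finset.sum_congr rfl fun k hk => (hw k hk).2, Finset.sum_comm, Finset.mul_sum]
  exact Finset.sum_le_sum fun l _ => hy t _

theorem sum_product_tens {ι κ : Type*} (s : Finset ι) (t : Finset κ) (α : ι × κ → ℂ)
    (x : ι → H₁) (y : κ → H₂) :
    ∑ p ∈ s ×ˢ t, α p • tens (x p.1) (y p.2) =
      ∑ k ∈ t, tens (∑ i ∈ s, α (i, k) • x i) (y k) := by
  rw [Finset.sum_product_right]
  refine Finset.sum_congr rfl fun k _ => ?_
  simp [← tensL_apply]

/-- Padding the coefficients by zero replaces a finite index set by a rectangle, over which the two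
summations can be separated. -/
theorem exists_product_extension {ι κ F : Type*} [DecidableEq ι] [DecidableEq κ]
    [AddCommGroup F] [Module ℂ F] (s : Finset (ι × κ)) (α : ι × κ → ℂ) (z : ι × κ → F) :
    ∃ (s₁ : Finset ι) (s₂ : Finset κ) (β : ι × κ → ℂ),
      ∑ p ∈ s, ‖α p‖ ^ 2 = ∑ p ∈ s₁ ×ˢ s₂, ‖β p‖ ^ 2 ∧
      ∑ p ∈ s, α p • z p = ∑ p ∈ s₁ ×ˢ s₂, β p • z p := by
  have hsub : s ⊆ s.image Prod.fst ×ˢ s.image Prod.snd := fun p hp => Finset.mem_product.2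
    ⟨Finset.mem_image_of_mem _ hp, Finset.mem_image_of_mem _ hp⟩
  refine ⟨s.image Prod.fst, s.image Prod.snd, fun p => if p ∈ s then α p else 0, ?_, ?_⟩
  · rw [← Finset.sum_subset hsub fun p _ hp => by simp [hp]]
    exact Finset.sum_congr rfl fun p hp => by simp [hp]
  · rw [← Finset.sum_subset hsub fun p _ hp => by simp [hp]]
    exact Finset.sum_congr rfl fun p hp => by simp [hp]

theorem IsBesselWith.tens {ι κ : Type*} {C D : ℝ} (hD : 0 ≤ D) {x : ι → H₁} {y : κ → H₂}
    (hx : IsBesselWith C x) (hy : IsBesselWith D y) :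
    IsBesselWith (D * C) fun p : ι × κ => tens (x p.1) (y p.2) := by
  classical
  intro s α
  obtain ⟨s₁, s₂, β, h1, h2⟩ := exists_product_extension s α
    fun p : ι × κ => UVSampling.tens (x p.1) (y p.2)
  rw [h1, h2, sum_product_tens]
  refine (hy.norm_sq_sum_tens_le s₂ _).trans ?_
  rw [Finset.sum_product_right, mul_assoc, Finset.mul_sum s₂ _ C]
  gcongr with k
  exact hx s₁ fun i => β (i, k)

theorem IsLowerRieszWith.tens {ι κ : Type*} {c d : ℝ} (hd : 0 ≤ d) {x : ι → H₁} {y : κ → H₂}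
    (hx : IsLowerRieszWith c x) (hy : IsLowerRieszWith d y) :
    IsLowerRieszWith (d * c) fun p : ι × κ => tens (x p.1) (y p.2) := by
  classical
  intro s α
  obtain ⟨s₁, s₂, β, h1, h2⟩ := exists_product_extension s α
    fun p : ι × κ => UVSampling.tens (x p.1) (y p.2)
  rw [h1, h2, sum_product_tens]
  refine le_trans ?_ (hy.le_norm_sq_sum_tens s₂ _)
  rw [Finset.sum_product_right, mul_assoc, Finset.mul_sum s₂ _ c]
  gcongr with k
  exact hx s₁ fun i => β (i, k)

/-- The tensor map is continuous in each variable, so the closure is taken first in v with `x i`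
fixed, then in u with v fixed. -/
theorem tens_mem_of_mem_closure {ι κ : Type*} {x : ι → H₁} {y : κ → H₂}
    {N : Submodule ℂ (HTensor H₁ H₂)} (hN : IsClosed (N : Set (HTensor H₁ H₂)))
    (h : ∀ i k, tens (x i) (y k) ∈ N) {u : H₁} {v : H₂}
    (hu : u ∈ (Submodule.span ℂ (Set.range x)).topologicalClosure)
    (hv : v ∈ (Submodule.span ℂ (Set.range y)).topologicalClosure) : tens u v ∈ N := by
  have h1 : ∀ i, (Submodule.span ℂ (Set.range y)).topologicalClosure ≤
      N.comap (tensL (x i)).toLinearMap := fun i => by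
    refine Submodule.topologicalClosure_minimal _ (Submodule.span_le.2 ?_)
      (hN.preimage (tensL (x i)).continuous)
    rintro _ ⟨k, rfl⟩
    exact h i k
  have h2 : (Submodule.span ℂ (Set.range x)).topologicalClosure ≤
      N.comap (tensL.flip v).toLinearMap := by
    refine Submodule.topologicalClosure_minimal _ (Submodule.span_le.2 ?_)
      (hN.preimage (tensL.flip v).continuous)
    rintro _ ⟨i, rfl⟩
    exact h1 i hv
  exact h2 hu

theorem closure_span_tens_le {ι κ ι' κ' : Type*} {x : ι → H₁} {y : κ → H₂} {x' : ι' → H₁}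
    {y' : κ' → H₂} (hx : ∀ i, x i ∈ (Submodule.span ℂ (Set.range x')).topologicalClosure)
    (hy : ∀ k, y k ∈ (Submodule.span ℂ (Set.range y')).topologicalClosure) :
    (Submodule.span ℂ (Set.range fun p : ι × κ => tens (x p.1) (y p.2))).topologicalClosure ≤
    (Submodule.span ℂ (Set.range fun p : ι' × κ' => tens (x' p.1) (y' p.2))).topologicalClosure := by
  refine Submodule.topologicalClosure_minimal _ (Submodule.span_le.2 ?_)
    (Submodule.isClosed_topologicalClosure _)
  rintro _ ⟨p, rfl⟩
  exact tens_mem_of_mem_closure (Submodule.isClosed_topologicalClosure _)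
    (fun i k => Submodule.le_topologicalClosure (Submodule.span ℂ (Set.range
      fun p : ι' × κ' => tens (x' p.1) (y' p.2))) (Submodule.subset_span ⟨(i, k), rfl⟩))
    (hx p.1) (hy p.2)

variable [CompleteSpace H₁] [CompleteSpace H₂]

/-- The tensor product of two Riesz bases is a Riesz basis. -/
theorem IsRieszBasis.tens {ι κ ι' κ' : Type*} [DecidableEq ι] [DecidableEq κ] {x : ι → H₁}
    {y : κ → H₂} {x' : ι' → H₁} {y' : κ' → H₂}
    (hx : IsRieszBasis x (Submodule.span ℂ (Set.range x')).topologicalClosure)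
    (hy : IsRieszBasis y (Submodule.span ℂ (Set.range y')).topologicalClosure) :
    IsRieszBasis (fun p : ι × κ => tens (x p.1) (y p.2))
      (Submodule.span ℂ
        (Set.range fun p : ι' × κ' => UVSampling.tens (x' p.1) (y' p.2))).topologicalClosure := by
  obtain ⟨C, -, hC⟩ := hx.isBesselWith
  obtain ⟨D, hD, hD'⟩ := hy.isBesselWith
  obtain ⟨c, hc, hc'⟩ := hx.isLowerRieszWith
  obtain ⟨d, hd, hd'⟩ := hy.isLowerRieszWith
  have := isRieszSequence_of_bounds (mul_pos hd hc) (hc'.tens hd.le hd') (hC.tens hD.le hD')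
  unfold IsRieszSequence at this
  convert this using 1
  refine le_antisymm (closure_span_tens_le (fun i => ?_) fun k => ?_)
    (closure_span_tens_le hx.mem hy.mem)
  · rw [← hx.eq_closure]
    exact Submodule.le_topologicalClosure _ (Submodule.subset_span ⟨i, rfl⟩)
  · rw [← hy.eq_closure]
    exact Submodule.le_topologicalClosure _ (Submodule.subset_span ⟨k, rfl⟩)

theorem IsRieszBasis.reindex {ι κ E : Type*} [DecidableEq ι] [DecidableEq κ]
    [NormedAddCommGroup E] [InnerProductSpace ℂ E] [CompleteSpace E] {x : ι → E}
    {M : Submodule ℂ E} (h : IsRieszBasis x M) (e : κ ≃ ι) :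
    IsRieszBasis (x ∘ e) M := by
  obtain ⟨C, -, hC⟩ := h.isBesselWith
  obtain ⟨c, hc, hc'⟩ := h.isLowerRieszWith
  have := isRieszSequence_of_bounds (x := x ∘ e) (c := c) (C := C) hc
    (fun s α => by simpa using hc' (s.map e.toEmbedding) (α ∘ e.symm))
    (fun s α => by simpa using hC (s.map e.toEmbedding) (α ∘ e.symm))
  rwa [IsRieszSequence, e.surjective.range_comp, ← h.eq_closure] at this

end Tensor

/-! ### Smallest eigenvalues and quadratic forms -/

section Matrix

open Matrix

variable {n : Type*} [Fintype n] [DecidableEq n]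

theorem le_eigenvalues_iff {A : Matrix n n ℂ} (hA : A.IsHermitian) (c : ℝ) :
    (∀ i, c ≤ hA.eigenvalues i) ↔
      ∀ w : n → ℂ, c * ∑ j, ‖w j‖ ^ 2 ≤ RCLike.re (star w ⬝ᵥ (A *ᵥ w)) := by
  have hinner : ∀ u v : n → ℂ, star u ⬝ᵥ v = inner ℂ (WithLp.toLp 2 u) (WithLp.toLp 2 v) := by
    intro u v
    simp [PiLp.inner_apply, dotProduct, mul_comm]
  constructor
  · intro h w
    set b := hA.eigenvectorBasis
    set v : EuclideanSpace ℂ n := WithLp.toLp 2 w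
    have h1 : ∀ i, (inner ℂ (b i) (WithLp.toLp 2 (A *ᵥ w)) : ℂ) =
        hA.eigenvalues i * inner ℂ (b i) v := by
      intro i
      have := hA.mulVec_eigenvectorBasis i
      rw [← WithLp.toLp_ofLp 2 (b i), ← hinner, ← hinner, dotProduct_mulVec,
        ← star_star (_ ᵥ* A), star_vecMul, star_star, hA.eq, this, star_smul, smul_dotProduct]
      simp [b]
    have h2 : star w ⬝ᵥ (A *ᵥ w) = ((∑ i, hA.eigenvalues i * ‖(inner ℂ (b i) v : ℂ)‖ ^ 2 : ℝ) : ℂ) := by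
      rw [hinner, ← b.sum_inner_mul_inner]
      push_cast
      refine Finset.sum_congr rfl fun i _ => ?_
      rw [h1, mul_left_comm, ← inner_conj_symm v (b i), Complex.conj_mul']
    have h3 : ∑ j, ‖w j‖ ^ 2 = ∑ i, ‖(inner ℂ (b i) v : ℂ)‖ ^ 2 := by
      rw [b.sum_sq_norm_inner_right, EuclideanSpace.norm_sq_eq]
    rw [h2, h3, Finset.mul_sum]
    simp only [RCLike.re_to_complex, Complex.ofReal_re]
    gcongr with i
    exact h i
  · intro h i
    have h1 := h (hA.eigenvectorBasis i)
    rw [← EuclideanSpace.norm_sq_eq, OrthonormalBasis.norm_eq_one] at h1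
    rw [hA.eigenvalues_eq]
    simpa using h1

/-- As G is square, G*G and GG* have the same characteristic polynomial, so the bound may be read
off the form of GG*, which is ‖G*w‖². That is the form met when summing Riesz sequences; `hr` makes
the infimum run over a nonempty set. -/
theorem le_lambdaMin_iff {r : ℕ} (hr : 0 < r) (G : Matrix (Fin r) (Fin r) ℂ) (c : ℝ) :
    c ≤ lambdaMin G ↔ ∀ w : Fin r → ℂ,
      c * ∑ j, ‖w j‖ ^ 2 ≤ ∑ k, ‖∑ j, conj (G j k) * w j‖ ^ 2 := by
  have : Nonempty (Fin r) := ⟨⟨0, hr⟩⟩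
  have hN : (G * Gᴴ).IsHermitian := isHermitian_mul_conjTranspose_self G
  have h1 : c ≤ lambdaMin G ↔
      ∀ i, c ≤ (isHermitian_conjTranspose_mul_self G).eigenvalues i :=
    le_ciInf_iff (Set.finite_range _).bddBelow
  have h2 : (isHermitian_conjTranspose_mul_self G).eigenvalues = hN.eigenvalues := by
    rw [Matrix.IsHermitian.eigenvalues_eq_eigenvalues_iff, charpoly_mul_comm]
  rw [h1, h2, le_eigenvalues_iff]
  refine forall_congr' fun w => ?_
  have : star w ⬝ᵥ ((G * Gᴴ) *ᵥ w) = ((∑ k, ‖∑ j, conj (G j k) * w j‖ ^ 2 : ℝ) : ℂ) := by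
    rw [← mulVec_mulVec, dotProduct_mulVec, ← star_star (_ ᵥ* G), star_vecMul, star_star]
    simp only [dotProduct, mulVec, conjTranspose_apply, Pi.star_apply, RCLike.star_def]
    push_cast
    exact Finset.sum_congr rfl fun k _ => Complex.conj_mul' _
  rw [this]
  rfl

end Matrix

/-! ### Periodization over the translates by 1/r -/

section Circle

/-- Summation of a function on `ℝ/ℤ` over the translates by the multiples of `1/r`. -/
def shiftSum {M : Type*} [AddCommMonoid M] (r : ℕ) (f : AddCircle (1 : ℝ) → M)
    (x : AddCircle (1 : ℝ)) : M :=
  ∑ k : Fin r, f (x + (((k : ℕ) / (r : ℝ) : ℝ) : AddCircle (1 : ℝ)))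

/-- The shift moves term k to term k + 1, and the last term r/r = 1 wraps around to k = 0. -/
theorem shiftSum_periodic {M : Type*} [AddCommGroup M] {r : ℕ} (hr : 0 < r)
    (f : AddCircle (1 : ℝ) → M) :
    Function.Periodic (shiftSum r f) ((1 / (r : ℝ) : ℝ) : AddCircle (1 : ℝ)) := by
  intro x
  have hr0 : (r : ℝ) ≠ 0 := by positivity
  have h : ∀ y, shiftSum r f y =
      ∑ k ∈ Finset.range r, f (y + (((k : ℕ) / (r : ℝ) : ℝ) : AddCircle (1 : ℝ))) := fun y =>
    Fin.sum_univ_eq_sum_range (fun k => f (y + (((k : ℕ) / (r : ℝ) : ℝ) : AddCircle (1 : ℝ)))) r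
  have h1 : ∀ k : ℕ, f (x + ((1 / (r : ℝ) : ℝ) : AddCircle (1 : ℝ)) +
      (((k : ℕ) / (r : ℝ) : ℝ) : AddCircle (1 : ℝ))) =
      f (x + ((((k + 1 : ℕ) : ℝ) / (r : ℝ) : ℝ) : AddCircle (1 : ℝ))) := by
    intro k
    rw [add_assoc, ← AddCircle.coe_add]
    congr 3
    push_cast
    ring
  simp only [h, h1]
  have h2 := Finset.sum_range_succ
    (fun k : ℕ => f (x + ((((k : ℕ) : ℝ) / (r : ℝ) : ℝ) : AddCircle (1 : ℝ)))) r
  rw [Finset.sum_range_succ'] at h2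
  have h3 : (((r : ℝ) / (r : ℝ) : ℝ) : AddCircle (1 : ℝ)) = 0 := by
    rw [div_self hr0]
    exact AddCircle.coe_period 1
  simpa [h3] using h2

/-- The section `y ↦ y / r` of the map `x ↦ r x` of `ℝ/ℤ`. -/
def divSection (r : ℕ) (y : AddCircle (1 : ℝ)) : AddCircle (1 : ℝ) :=
  ((r : ℝ)⁻¹ * (AddCircle.equivIoc 1 0 y : ℝ) : ℝ)

theorem measurable_divSection (r : ℕ) : Measurable (divSection r) :=
  AddCircle.measurable_mk'.comp <| (measurable_const_mul _).comp <|
    measurable_subtype_coe.comp (AddCircle.measurableEquivIoc (1 : ℝ) 0).measurable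

/-- `divSection` inverts x ↦ rx up to a multiple of 1/r, which f does not see. Hence a 1/r-periodic
f factors through x ↦ rx, with factor `f ∘ divSection r`. -/
theorem periodic_comp_divSection {M : Type*} {r : ℕ} (hr : 0 < r)
    {f : AddCircle (1 : ℝ) → M}
    (hf : Function.Periodic f ((1 / (r : ℝ) : ℝ) : AddCircle (1 : ℝ))) (x : AddCircle (1 : ℝ)) :
    f (divSection r ((r : ℤ) • x)) = f x := by
  have hr0 : (r : ℝ) ≠ 0 := by positivity
  induction x using QuotientAddGroup.induction_on with | _ t
  have h1 : ((AddCircle.equivIoc 1 0 ((r : ℤ) • (t : AddCircle (1 : ℝ))) : ℝ) :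
      AddCircle (1 : ℝ)) = (((r : ℤ) • t : ℝ) : AddCircle (1 : ℝ)) := by
    rw [AddCircle.coe_equivIoc]
    rfl
  set s : ℝ := (AddCircle.equivIoc 1 0 ((r : ℤ) • (t : AddCircle (1 : ℝ))) : ℝ) with hs
  rw [← sub_eq_zero, ← AddCircle.coe_sub, AddCircle.coe_eq_zero_iff] at h1
  obtain ⟨m, hm⟩ := h1
  have h2 : divSection r ((r : ℤ) • (t : AddCircle (1 : ℝ))) =
      (t : AddCircle (1 : ℝ)) + m • ((1 / (r : ℝ) : ℝ) : AddCircle (1 : ℝ)) := by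
    rw [divSection, ← hs, ← AddCircle.coe_zsmul, ← AddCircle.coe_add]
    congr 1
    simp only [zsmul_eq_mul, Int.cast_natCast] at hm ⊢
    field_simp
    linarith
  exact h2 ▸ hf.zsmul m _

theorem measurePreserving_mul {r : ℕ} (hr : 0 < r) :
    MeasurePreserving (fun x : AddCircle (1 : ℝ) => (r : ℤ) • x) haarAddCircle haarAddCircle :=
  Measure.measurePreserving_zsmul _ (by exact_mod_cast hr.ne')

theorem volume_eq_haarAddCircle :
    (volume : Measure (AddCircle (1 : ℝ))) = haarAddCircle := by
  rw [volume_eq_smul_haarAddCircle]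
  simp

/-- Scaling carries (0, 1/r) to a full period, and x ↦ rx preserves Haar measure. This takes the
essential infimum over (0, 1/r) to an a.e. statement on the circle. -/
theorem ae_Ioo_iff_of_periodic {r : ℕ} (hr : 0 < r) {p : AddCircle (1 : ℝ) → Prop}
    (hp : Function.Periodic p ((1 / (r : ℝ) : ℝ) : AddCircle (1 : ℝ))) :
    (∀ᵐ x : ℝ ∂volume.restrict (Set.Ioo (0 : ℝ) (1 / r)), p x) ↔
      ∀ᵐ x ∂(haarAddCircle : Measure (AddCircle (1 : ℝ))), p x := by
  have hr0 : (0 : ℝ) < r := by positivity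
  have hr1 : (1 : ℝ) ≤ r := by exact_mod_cast hr
  rw [← volume_eq_haarAddCircle]
  constructor
  · intro h
    rw [restrict_Ioo_eq_restrict_Ioc, ae_restrict_iff' measurableSet_Ioc] at h
    have h1 : Measure.QuasiMeasurePreserving (fun x : ℝ => (r : ℝ)⁻¹ * x) volume volume := by
      refine ⟨measurable_const_mul _, ?_⟩
      rw [Real.map_volume_mul_left (by positivity)]
      exact Measure.smul_absolutelyContinuous
    have h2 := h1.ae h
    have h3 : ∀ᵐ x : ℝ ∂volume.restrict (Set.Ioc (0 : ℝ) (0 + 1)),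
        p (((r : ℝ)⁻¹ * x : ℝ) : AddCircle (1 : ℝ)) := by
      rw [ae_restrict_iff' measurableSet_Ioc]
      filter_upwards [h2] with x hx hx1
      refine hx ⟨mul_pos (by positivity) hx1.1, ?_⟩
      rw [one_div]
      exact mul_le_of_le_one_right (by positivity) (by linarith [hx1.2])
    have hc : MeasurePreserving ((↑) : Set.Ioc (0 : ℝ) (0 + 1) → ℝ) (Measure.comap Subtype.val volume)
        (volume.restrict (Set.Ioc (0 : ℝ) (0 + 1))) :=
      ⟨measurable_subtype_coe, map_comap_subtype_coe measurableSet_Ioc _⟩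
    have h4 : MeasurePreserving (fun y : AddCircle (1 : ℝ) => (AddCircle.equivIoc 1 0 y : ℝ))
        volume (volume.restrict (Set.Ioc (0 : ℝ) (0 + 1))) :=
      hc.comp (AddCircle.measurePreserving_equivIoc (1 : ℝ) (a := 0))
    have h5 : ∀ᵐ y ∂(volume : Measure (AddCircle (1 : ℝ))), p (divSection r y) := by
      simpa only [divSection] using h4.quasiMeasurePreserving.ae h3
    rw [volume_eq_haarAddCircle] at h5 ⊢
    filter_upwards [(measurePreserving_mul hr).quasiMeasurePreserving.ae h5] with x hx
    rwa [periodic_comp_divSection hr hp] at hx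
  · intro h
    have h1 := (AddCircle.measurePreserving_mk (1 : ℝ) 0).quasiMeasurePreserving.ae h
    refine ae_restrict_of_ae_restrict_of_subset ?_ h1
    intro x hx
    refine ⟨hx.1, ?_⟩
    have : 1 / (r : ℝ) ≤ 1 := (div_le_one hr0).2 hr1
    linarith [hx.2]

/-- The squared norm `‖G(x)* w‖²`, where `G(x)` is the matrix of the translates of `g`. -/
def fiberNormSq {s : ℕ} (r : ℕ) (g : Fin s → AddCircle (1 : ℝ) → ℂ) (w : Fin s → ℂ) :
    AddCircle (1 : ℝ) → ℝ :=
  shiftSum r fun y => ‖∑ j, conj (g j y) * w j‖ ^ 2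

theorem alphaConst_pos_iff {r : ℕ} (hr : 0 < r) (g : Fin r → AddCircle (1 : ℝ) → ℂ) :
    0 < alphaConst r g ↔ ∃ c : ℝ, 0 < c ∧
      ∀ᵐ x ∂(haarAddCircle : Measure (AddCircle (1 : ℝ))), ∀ w : Fin r → ℂ,
        c * ∑ j, ‖w j‖ ^ 2 ≤ fiberNormSq r g w x := by
  have key : ∀ c : ℝ, (∀ᵐ x : ℝ ∂volume.restrict (Set.Ioo (0 : ℝ) (1 / r)),
      c ≤ lambdaMin (periodMatrix r g x)) ↔
      ∀ᵐ x ∂(haarAddCircle : Measure (AddCircle (1 : ℝ))), ∀ w : Fin r → ℂ,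
        c * ∑ j, ‖w j‖ ^ 2 ≤ fiberNormSq r g w x := by
    intro c
    rw [← ae_Ioo_iff_of_periodic hr (p := fun x => ∀ w : Fin r → ℂ,
        c * ∑ j, ‖w j‖ ^ 2 ≤ fiberNormSq r g w x)
        (fun x => by simp only [fiberNormSq, (shiftSum_periodic hr _) x])]
    refine Filter.eventually_congr (Filter.Eventually.of_forall fun x => ?_)
    rw [le_lambdaMin_iff hr]
    simp [fiberNormSq, shiftSum, periodMatrix]
  simp only [← key]
  constructor
  · intro h
    obtain ⟨c, hc, hc'⟩ := ENNReal.lt_iff_exists_nnreal_btwn.1 h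
    have hc0 : 0 < c := by exact_mod_cast hc
    refine ⟨c, hc0, ?_⟩
    filter_upwards [ae_lt_of_lt_essInf hc'] with x hx
    rw [ENNReal.lt_ofReal_iff_toReal_lt ENNReal.coe_ne_top] at hx
    exact hx.le
  · rintro ⟨c, hc, h⟩
    refine lt_of_lt_of_le (ENNReal.ofReal_pos.2 hc) (le_essInf_of_ae_le _ ?_)
    filter_upwards [h] with x hx
    exact ENNReal.ofReal_le_ofReal hx

end Circle

/-! ### The functions conj g_j · φ_j(r·) and their norms -/

section Dilation

/-- The space `L²(ℝ/ℤ)`. -/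
abbrev L2Circle : Type := Lp ℂ 2 (haarAddCircle : Measure (AddCircle (1 : ℝ)))

theorem L2Circle.integrable_norm_sq (f : L2Circle) :
    Integrable (fun x => ‖f x‖ ^ 2) haarAddCircle :=
  (Lp.memLp f).norm.integrable_sq

theorem L2Circle.norm_sq_eq (f : L2Circle) :
    ‖f‖ ^ 2 = ∫ x, ‖f x‖ ^ 2 ∂haarAddCircle := by
  have h : (inner ℂ f f : ℂ) = ((∫ x, ‖f x‖ ^ 2 ∂haarAddCircle : ℝ) : ℂ) := by
    rw [L2.inner_def]
    refine Eq.trans (integral_congr_ae (ae_of_all _ fun x => ?_)) integral_ofReal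
    simp [inner_self_eq_norm_sq_to_K]
  rw [inner_self_eq_norm_sq_to_K, ← RCLike.ofReal_pow] at h
  exact Complex.ofReal_injective h

/-- Functions of rx are constant along each fibre x + k/r, so they pass through `shiftSum` as
scalars. -/
theorem zsmul_add_div {r : ℕ} (hr : 0 < r) (x : AddCircle (1 : ℝ)) (k : ℕ) :
    (r : ℤ) • (x + (((k : ℕ) / (r : ℝ) : ℝ) : AddCircle (1 : ℝ))) = (r : ℤ) • x := by
  have hr0 : (r : ℝ) ≠ 0 := by positivity
  rw [smul_add, ← AddCircle.coe_zsmul, add_eq_left, AddCircle.coe_eq_zero_iff]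
  refine ⟨k, ?_⟩
  simp only [zsmul_eq_mul, Int.cast_natCast]
  field_simp

theorem integrable_shiftSum {E : Type*} [NormedAddCommGroup E] {r : ℕ}
    {f : AddCircle (1 : ℝ) → E} (hf : Integrable f haarAddCircle) :
    Integrable (shiftSum r f) haarAddCircle :=
  integrable_finsetSum _ fun _ _ => hf.comp_add_right _

theorem integral_shiftSum {E : Type*} [NormedAddCommGroup E] [NormedSpace ℝ E] {r : ℕ}
    {f : AddCircle (1 : ℝ) → E} (hf : Integrable f haarAddCircle) :
    ∫ x, shiftSum r f x ∂haarAddCircle = (r : ℝ) • ∫ x, f x ∂haarAddCircle := by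
  simp only [shiftSum]
  rw [integral_finsetSum _ fun _ _ => hf.comp_add_right _]
  simp [integral_add_right_eq_self, Nat.cast_smul_eq_nsmul]

theorem memLp_shiftSum {r : ℕ} {f : AddCircle (1 : ℝ) → ℂ} (hf : MemLp f 2 haarAddCircle) :
    MemLp (shiftSum r f) 2 haarAddCircle :=
  memLp_finsetSum _ fun _ _ => hf.comp_measurePreserving (measurePreserving_add_right _ _)

theorem measurable_shiftSum {E : Type*} [NormedAddCommGroup E] [MeasurableSpace E]
    [BorelSpace E] [SecondCountableTopology E] {r : ℕ}
    {f : AddCircle (1 : ℝ) → E} (hf : Measurable f) : Measurable (shiftSum r f) :=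
  Finset.measurable_sum _ fun _ _ => hf.comp (measurable_add_const _)

theorem integral_comp_zsmul {E : Type*} [NormedAddCommGroup E] [NormedSpace ℝ E] {r : ℕ}
    (hr : 0 < r) {f : AddCircle (1 : ℝ) → E} (hf : AEStronglyMeasurable f haarAddCircle) :
    ∫ x, f ((r : ℤ) • x) ∂haarAddCircle = ∫ x, f x ∂haarAddCircle := by
  have h := measurePreserving_mul hr
  conv_rhs => rw [← h.map_eq]
  rw [integral_map h.measurable.aemeasurable (by rwa [h.map_eq])]

/-- The operator `φ ↦ φ(r ·)` on `L²(ℝ/ℤ)`. -/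
def dilation {r : ℕ} (hr : 0 < r) : L2Circle →ₗᵢ[ℂ] L2Circle :=
  Lp.compMeasurePreservingₗᵢ ℂ _ (measurePreserving_mul hr)

theorem coeFn_dilation {r : ℕ} (hr : 0 < r) (φ : L2Circle) :
    dilation hr φ =ᵐ[haarAddCircle] fun x => φ ((r : ℤ) • x) :=
  Lp.coeFn_compMeasurePreserving φ (measurePreserving_mul hr)

/-- The operator `φ ↦ conj g · φ(r ·)` on `L²(ℝ/ℤ)`, for a bounded function `g`. -/
def conjMulDilation {r : ℕ} (hr : 0 < r) {g : AddCircle (1 : ℝ) → ℂ}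
    (hg : MemLp g ∞ haarAddCircle) : L2Circle →L[ℂ] L2Circle :=
  (ContinuousLinearMap.mul ℂ ℂ).holderL haarAddCircle ∞ 2 2 (hg.star.toLp _) ∘L
    (dilation hr).toContinuousLinearMap

theorem coeFn_conjMulDilation {r : ℕ} (hr : 0 < r) {g : AddCircle (1 : ℝ) → ℂ}
    (hg : MemLp g ∞ haarAddCircle) (φ : L2Circle) :
    conjMulDilation hr hg φ =ᵐ[haarAddCircle] fun x => conj (g x) * φ ((r : ℤ) • x) := by
  filter_upwards [coeFn_dilation hr φ, hg.star.coeFn_toLp,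
    (ContinuousLinearMap.mul ℂ ℂ).coeFn_holder (r := 2) (hg.star.toLp _) (dilation hr φ)]
    with x h1 h2 h3
  refine h3.trans ?_
  rw [h1, h2]
  rfl

variable {r : ℕ} (hr : 0 < r) {g : Fin r → AddCircle (1 : ℝ) → ℂ}
  (hg : ∀ j, MemLp (g j) ∞ haarAddCircle)

theorem coeFn_sum_conjMulDilation (φ : Fin r → L2Circle) :
    (∑ j, conjMulDilation hr (hg j) (φ j) : L2Circle) =ᵐ[haarAddCircle]
      fun x => ∑ j, conj (g j x) * φ j ((r : ℤ) • x) := by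
  have h := ae_all_iff.2 fun j => coeFn_conjMulDilation hr (hg j) (φ j)
  filter_upwards [h, Lp.coeFn_finsetSum Finset.univ fun j => conjMulDilation hr (hg j) (φ j)]
    with x h1 h2
  rw [h2, Finset.sum_apply]
  exact Finset.sum_congr rfl fun j _ => h1 j

theorem integrable_norm_sq_sum {r : ℕ} (hr : 0 < r) {g : Fin r → AddCircle (1 : ℝ) → ℂ}
    (hg : ∀ j, MemLp (g j) ∞ haarAddCircle) (φ : Fin r → L2Circle) :
    Integrable (fun x => ‖∑ j, conj (g j x) * φ j ((r : ℤ) • x)‖ ^ 2) haarAddCircle := by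
  refine (L2Circle.integrable_norm_sq (∑ j, conjMulDilation hr (hg j) (φ j))).congr ?_
  filter_upwards [coeFn_sum_conjMulDilation hr hg φ] with x hx
  rw [hx]

/-- Averaging the integrand over the r translates leaves the integral unchanged. On each fibre the
φ_j(rx) are constants, so what remains is the quadratic form of GG*. -/
theorem norm_sq_sum_conjMulDilation (φ : Fin r → L2Circle) :
    (r : ℝ) * ‖∑ j, conjMulDilation hr (hg j) (φ j)‖ ^ 2 =
      ∫ x, fiberNormSq r g (fun j => φ j ((r : ℤ) • x)) x ∂haarAddCircle := by
  rw [L2Circle.norm_sq_eq, ← smul_eq_mul]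
  have h1 : ∫ x, ‖(∑ j, conjMulDilation hr (hg j) (φ j) : L2Circle) x‖ ^ 2 ∂haarAddCircle =
      ∫ x, ‖∑ j, conj (g j x) * φ j ((r : ℤ) • x)‖ ^ 2 ∂haarAddCircle := by
    refine integral_congr_ae ?_
    filter_upwards [coeFn_sum_conjMulDilation hr hg φ] with x hx
    rw [hx]
  rw [h1, ← integral_shiftSum (integrable_norm_sq_sum hr hg φ)]
  simp only [shiftSum, fiberNormSq, zsmul_add_div hr]

theorem integrable_fiberNormSq {r : ℕ} (hr : 0 < r) {g : Fin r → AddCircle (1 : ℝ) → ℂ}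
    (hg : ∀ j, MemLp (g j) ∞ haarAddCircle) (φ : Fin r → L2Circle) :
    Integrable (fun x => fiberNormSq r g (fun j => φ j ((r : ℤ) • x)) x) haarAddCircle := by
  have := integrable_shiftSum (r := r) (integrable_norm_sq_sum hr hg φ)
  unfold shiftSum at this
  simpa only [shiftSum, fiberNormSq, zsmul_add_div hr] using this

theorem integrable_norm_sq_comp_zsmul {r : ℕ} (hr : 0 < r) (φ : L2Circle) :
    Integrable (fun x => ‖φ ((r : ℤ) • x)‖ ^ 2) haarAddCircle := by
  have h := (measurePreserving_mul hr).integrable_comp_of_integrable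
    (g := fun x => ‖φ x‖ ^ 2) (L2Circle.integrable_norm_sq φ)
  exact h

theorem sum_norm_sq_eq_integral {r : ℕ} (hr : 0 < r) (φ : Fin r → L2Circle) :
    ∑ j, ‖φ j‖ ^ 2 = ∫ x, ∑ j, ‖φ j ((r : ℤ) • x)‖ ^ 2 ∂haarAddCircle := by
  rw [integral_finsetSum _ fun j _ => integrable_norm_sq_comp_zsmul hr (φ j)]
  refine Finset.sum_congr rfl fun j _ => ?_
  rw [L2Circle.norm_sq_eq]
  exact (integral_comp_zsmul hr
    (L2Circle.integrable_norm_sq (φ j)).aestronglyMeasurable).symm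

theorem le_norm_sq_sum_conjMulDilation {c : ℝ}
    (hc : ∀ᵐ x ∂(haarAddCircle : Measure (AddCircle (1 : ℝ))), ∀ w : Fin r → ℂ,
      c * ∑ j, ‖w j‖ ^ 2 ≤ fiberNormSq r g w x) (φ : Fin r → L2Circle) :
    c / r * ∑ j, ‖φ j‖ ^ 2 ≤ ‖∑ j, conjMulDilation hr (hg j) (φ j)‖ ^ 2 := by
  have hr0 : (0 : ℝ) < r := by positivity
  have h : c * ∑ j, ‖φ j‖ ^ 2 ≤ r * ‖∑ j, conjMulDilation hr (hg j) (φ j)‖ ^ 2 := by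
    rw [norm_sq_sum_conjMulDilation, sum_norm_sq_eq_integral hr, ← integral_const_mul]
    refine integral_mono_ae ((integrable_finsetSum _ fun j _ =>
      integrable_norm_sq_comp_zsmul hr (φ j)).const_mul c) (integrable_fiberNormSq hr hg φ) ?_
    filter_upwards [hc] with x hx
    exact hx fun j => φ j ((r : ℤ) • x)
  rwa [div_mul_eq_mul_div, div_le_iff₀' hr0]

theorem norm_sq_sum_conjMulDilation_le (φ : Fin r → L2Circle) :
    ‖∑ j, conjMulDilation hr (hg j) (φ j)‖ ^ 2 ≤
      (∑ j, ‖conjMulDilation hr (hg j)‖ ^ 2) * ∑ j, ‖φ j‖ ^ 2 := by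
  refine le_trans ?_ (Finset.sum_mul_sq_le_sq_mul_sq _ _ _)
  gcongr
  exact (norm_sum_le _ _).trans (Finset.sum_le_sum fun j _ => ContinuousLinearMap.le_opNorm _ _)

theorem norm_sq_sum_fourierLp (t : Finset ℤ) (b : ℤ → ℂ) :
    ‖(∑ n ∈ t, b n • fourierLp 2 n : L2Circle)‖ ^ 2 = ∑ n ∈ t, ‖b n‖ ^ 2 := by
  have h := (orthonormal_fourier (T := 1)).inner_sum b b t
  simp only [inner_self_eq_norm_sq_to_K, Complex.conj_mul'] at h
  refine Complex.ofReal_injective ?_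
  push_cast
  exact h

/-- The functions `conj g_j(x) e^{2πirnx}`. -/
def modulates (i : Fin r × ℤ) : L2Circle :=
  conjMulDilation hr (hg i.1) (fourierLp 2 i.2)

/-- Grouping the terms by j, the φ_j are trigonometric polynomials and Parseval identifies the
norms. -/
theorem exists_sum_modulates_eq (s : Finset (Fin r × ℤ)) (α : Fin r × ℤ → ℂ) :
    ∃ φ : Fin r → L2Circle, ∑ i ∈ s, α i • modulates hr hg i =
        ∑ j, conjMulDilation hr (hg j) (φ j) ∧
      ∑ i ∈ s, ‖α i‖ ^ 2 = ∑ j, ‖φ j‖ ^ 2 := by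
  have hsub : s ⊆ Finset.univ ×ˢ s.image Prod.snd := fun p hp => Finset.mem_product.2
    ⟨Finset.mem_univ _, Finset.mem_image_of_mem _ hp⟩
  refine ⟨fun j => ∑ n ∈ s.image Prod.snd, (if (j, n) ∈ s then α (j, n) else 0) • fourierLp 2 n,
    ?_, ?_⟩
  · simp only [map_sum, map_smul]
    rw [← Finset.sum_product' Finset.univ (s.image Prod.snd)
      (f := fun j n => (if (j, n) ∈ s then α (j, n) else 0) •
        conjMulDilation hr (hg j) (fourierLp 2 n)),
      ← Finset.sum_subset hsub fun p _ hp => by simp [hp]]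
    exact Finset.sum_congr rfl fun p hp => by simp [hp, modulates]
  · simp only [norm_sq_sum_fourierLp]
    rw [← Finset.sum_product' Finset.univ (s.image Prod.snd)
      (f := fun j n => ‖(if (j, n) ∈ s then α (j, n) else 0)‖ ^ 2),
      ← Finset.sum_subset hsub fun p _ hp => by simp [hp]]
    exact Finset.sum_congr rfl fun p hp => by simp [hp]

theorem isBesselWith_modulates :
    IsBesselWith (∑ j, ‖conjMulDilation hr (hg j)‖ ^ 2) (modulates hr hg) := by
  intro s α
  obtain ⟨φ, h1, h2⟩ := exists_sum_modulates_eq hr hg s α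
  rw [h1, h2]
  exact norm_sq_sum_conjMulDilation_le hr hg φ

theorem isLowerRieszWith_modulates {c : ℝ}
    (hc : ∀ᵐ x ∂(haarAddCircle : Measure (AddCircle (1 : ℝ))), ∀ w : Fin r → ℂ,
      c * ∑ j, ‖w j‖ ^ 2 ≤ fiberNormSq r g w x) :
    IsLowerRieszWith (c / r) (modulates hr hg) := by
  intro s α
  obtain ⟨φ, h1, h2⟩ := exists_sum_modulates_eq hr hg s α
  rw [h1, h2]
  exact le_norm_sq_sum_conjMulDilation hr hg hc φ

end Dilation

/-! ### Completeness of the modulated family -/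

section Completeness

open Matrix in
-- The bound makes A* injective; A is square, so its determinant is nonzero and A is injective too.
theorem eq_zero_of_mulVec_eq_zero {n : Type*} [Fintype n] [DecidableEq n] {A : Matrix n n ℂ}
    {c : ℝ} (hc : 0 < c)
    (h : ∀ w : n → ℂ, c * ∑ j, ‖w j‖ ^ 2 ≤ ∑ k, ‖∑ j, conj (A j k) * w j‖ ^ 2)
    {v : n → ℂ} (hv : A *ᵥ v = 0) : v = 0 := by
  have hdet : Aᴴ.det ≠ 0 := by
    intro h0
    obtain ⟨w, hw, hw0⟩ := exists_mulVec_eq_zero_iff.2 h0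
    have h1 : ∀ k, ∑ j, conj (A j k) * w j = 0 := fun k => congrFun hw0 k
    have h2 := h w
    simp only [h1, norm_zero, ne_eq, OfNat.ofNat_ne_zero, not_false_eq_true, zero_pow,
      Finset.sum_const_zero] at h2
    obtain ⟨j, hj⟩ := Function.ne_iff.1 hw
    have h3 : 0 < ∑ j, ‖w j‖ ^ 2 := Finset.sum_pos' (fun _ _ => sq_nonneg _)
      ⟨j, Finset.mem_univ _, pow_pos (norm_pos_iff.2 hj) 2⟩
    exact absurd h2 (not_le.2 (mul_pos hc h3))
  by_contra hv0
  refine hdet ?_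
  rw [det_conjTranspose, exists_mulVec_eq_zero_iff.1 ⟨v, hv0, hv⟩, star_zero]

theorem L2Circle.eq_zero_of_forall_inner_fourierLp {f : L2Circle}
    (h : ∀ n : ℤ, (inner ℂ (fourierLp 2 n : L2Circle) f : ℂ) = 0) : f = 0 := by
  apply (fourierBasis (T := (1 : ℝ))).repr.injective
  ext n
  rw [HilbertBasis.repr_apply_apply, coe_fourierBasis, h n]
  simp

/-- A `1/r`-periodic function in `L²` orthogonal to all `e^{2πirnx}` vanishes. -/
theorem ae_eq_zero_of_periodic_of_forall_integral {r : ℕ} (hr : 0 < r)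
    {f : AddCircle (1 : ℝ) → ℂ} (hfm : Measurable f) (hf : MemLp f 2 haarAddCircle)
    (hp : Function.Periodic f ((1 / (r : ℝ) : ℝ) : AddCircle (1 : ℝ)))
    (h : ∀ n : ℤ, ∫ x, conj (fourier n ((r : ℤ) • x) : ℂ) * f x ∂haarAddCircle = 0) :
    f =ᵐ[haarAddCircle] 0 := by
  have hmp := measurePreserving_mul hr
  set φ : AddCircle (1 : ℝ) → ℂ := f ∘ divSection r
  have hφm : Measurable φ := hfm.comp (measurable_divSection r)
  have hφr : ∀ x, φ ((r : ℤ) • x) = f x := fun x => periodic_comp_divSection hr hp x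
  have hφ : MemLp φ 2 haarAddCircle := by
    rw [← hmp.map_eq, memLp_map_measure_iff hφm.aestronglyMeasurable hmp.measurable.aemeasurable]
    convert hf using 1
    exact funext hφr
  have h0 : hφ.toLp φ = 0 := by
    refine L2Circle.eq_zero_of_forall_inner_fourierLp fun n => ?_
    have h1 : (inner ℂ (fourierLp 2 n : L2Circle) (hφ.toLp φ) : ℂ) =
        ∫ y, conj (fourier n y : ℂ) * φ y ∂haarAddCircle := by
      rw [L2.inner_def]
      refine integral_congr_ae ?_
      filter_upwards [coeFn_fourierLp (T := 1) 2 n, hφ.coeFn_toLp] with y hy1 hy2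
      rw [hy1, hy2]
      simp [mul_comm]
    have hm : Measurable fun y => conj (fourier n y : ℂ) * φ y :=
      (Complex.continuous_conj.comp (fourier n).continuous).measurable.mul hφm
    rw [h1, ← integral_comp_zsmul hr hm.aestronglyMeasurable, ← h n]
    simp only [hφr]
  have h2 : φ =ᵐ[haarAddCircle] 0 := by
    have := hφ.coeFn_toLp
    rw [h0] at this
    exact this.symm.trans (Lp.coeFn_zero _ _ _)
  filter_upwards [hmp.quasiMeasurePreserving.ae h2] with x hx
  rw [← hφr x, hx]
  rfl

/-- If F is orthogonal to the family, the periodization of g_j F is a 1/r-periodic function with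
vanishing coefficients, hence zero. So G(x) annihilates the vector of values F(x + k/r), and G(x) is
injective. -/
theorem closure_span_modulates {r : ℕ} (hr : 0 < r) {g : Fin r → AddCircle (1 : ℝ) → ℂ}
    (hgm : ∀ j, Measurable (g j)) (hg : ∀ j, MemLp (g j) ∞ haarAddCircle) {c : ℝ} (hc : 0 < c)
    (h : ∀ᵐ x ∂(haarAddCircle : Measure (AddCircle (1 : ℝ))), ∀ w : Fin r → ℂ,
      c * ∑ j, ‖w j‖ ^ 2 ≤ fiberNormSq r g w x) :
    (Submodule.span ℂ (Set.range (modulates hr hg))).topologicalClosure = ⊤ := by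
  rw [Submodule.topologicalClosure_eq_top_iff, Submodule.eq_bot_iff]
  intro F hF
  have hFm : Measurable F := (Lp.stronglyMeasurable F).measurable
  have hgF : ∀ j, MemLp (fun x => g j x * F x) 2 haarAddCircle := fun j =>
    (Lp.memLp F).mul' (hg j)
  have horth : ∀ j n, ∫ x, conj (fourier n ((r : ℤ) • x) : ℂ) * (g j x * F x) ∂haarAddCircle = 0 := by
    intro j n
    have h1 := (Submodule.mem_orthogonal _ F).1 hF (modulates hr hg (j, n))
      (Submodule.subset_span ⟨_, rfl⟩)
    rw [L2.inner_def] at h1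
    rw [← h1]
    refine integral_congr_ae ?_
    filter_upwards [coeFn_conjMulDilation hr (hg j) (fourierLp 2 n),
      (measurePreserving_mul hr).quasiMeasurePreserving.ae (coeFn_fourierLp (T := 1) 2 n)]
      with x h2 h3
    have h4 : modulates hr hg (j, n) x = conj (g j x) * fourier n ((r : ℤ) • x) := by
      rw [← h3]
      exact h2
    rw [h4]
    simp only [RCLike.inner_apply, map_mul, Complex.conj_conj]
    ring
  have hint : ∀ j n, Integrable
      (fun x => conj (fourier n ((r : ℤ) • x) : ℂ) * (g j x * F x)) haarAddCircle := by
    intro j n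
    refine ((hgF j).integrable (by norm_num)).bdd_mul (c := 1) ?_ ?_
    · have hm : Continuous fun x : AddCircle (1 : ℝ) => conj (fourier n ((r : ℤ) • x) : ℂ) :=
        Complex.continuous_conj.comp ((fourier n).continuous.comp (continuous_zsmul _))
      exact hm.aestronglyMeasurable
    · refine ae_of_all _ fun x => ?_
      rw [RCLike.norm_conj, fourier_apply, Circle.norm_coe]
  have hzero : ∀ j, shiftSum r (fun x => g j x * F x) =ᵐ[haarAddCircle] 0 := by
    intro j
    refine ae_eq_zero_of_periodic_of_forall_integral hr
      (measurable_shiftSum ((hgm j).mul hFm)) (memLp_shiftSum (hgF j))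
      (shiftSum_periodic hr _) fun n => ?_
    have h5 := integral_shiftSum (r := r) (hint j n)
    rw [horth j n, smul_zero] at h5
    rw [← h5]
    simp only [shiftSum, zsmul_add_div hr, Finset.mul_sum]
  rw [Lp.eq_zero_iff_ae_eq_zero]
  filter_upwards [h, ae_all_iff.2 hzero] with x hx hx0
  have h6 := eq_zero_of_mulVec_eq_zero (A := Matrix.of fun j (k : Fin r) =>
      g j (x + (((k : ℕ) / (r : ℝ) : ℝ) : AddCircle (1 : ℝ)))) hc (fun w => hx w)
    (v := fun k => F (x + (((k : ℕ) / (r : ℝ) : ℝ) : AddCircle (1 : ℝ))))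
    (funext fun j => hx0 j)
  -- The entry k = 0 of the fibre vector is F(x) itself.
  simpa using congrFun h6 ⟨0, hr⟩

end Completeness

/-! ### From the lower Riesz inequality to the pointwise bound -/

section LowerBound

variable {r : ℕ} (hr : 0 < r) {g : Fin r → AddCircle (1 : ℝ) → ℂ}
  (hg : ∀ j, MemLp (g j) ∞ haarAddCircle)

/-- The inequality with coefficients w_j times the Fourier coefficients of ψ, in the limit of the
partial sums. -/
theorem IsLowerRieszWith.le_norm_sq_conjMulDilation {c : ℝ}
    (h : IsLowerRieszWith c (modulates hr hg)) (w : Fin r → ℂ) (ψ : L2Circle) :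
    c * ((∑ j, ‖w j‖ ^ 2) * ‖ψ‖ ^ 2) ≤ ‖∑ j, conjMulDilation hr (hg j) (w j • ψ)‖ ^ 2 := by
  have h1 : HasSum (fun n : ℤ => (fourierBasis.repr ψ n) • (fourierLp 2 n : L2Circle)) ψ := by
    simpa only [coe_fourierBasis] using (fourierBasis (T := (1 : ℝ))).hasSum_repr ψ
  have h2 : Continuous fun ψ : L2Circle => ∑ j, conjMulDilation hr (hg j) (w j • ψ) := by
    fun_prop
  refine le_of_tendsto_of_tendsto'
    (((h1.norm.pow 2).const_mul (∑ j, ‖w j‖ ^ 2)).const_mul c)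
    (((h2.tendsto ψ).comp h1).norm.pow 2) fun t => ?_
  have h3 := h (Finset.univ ×ˢ t) fun i => w i.1 * fourierBasis.repr ψ i.2
  rw [norm_sq_sum_fourierLp, Finset.sum_mul_sum]
  simp only [Finset.sum_product, norm_mul, mul_pow] at h3
  refine h3.trans (le_of_eq ?_)
  simp only [modulates, Function.comp_apply, map_sum, map_smul, Finset.smul_sum, mul_smul]

/-- Taking ψ to be the indicator of a measurable set B turns the inequality into one between
integrals over B of functions of rx; as B is arbitrary, it holds a.e. The factor r is that of the
norm identity. -/
theorem fiberNormSq_ge_of_isLowerRieszWith (hgm : ∀ j, Measurable (g j)) {c : ℝ}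
    (h : IsLowerRieszWith c (modulates hr hg)) (w : Fin r → ℂ) :
    ∀ᵐ x ∂(haarAddCircle : Measure (AddCircle (1 : ℝ))),
      r * c * ∑ j, ‖w j‖ ^ 2 ≤ fiberNormSq r g w x := by
  have hmp := measurePreserving_mul hr
  set N := fiberNormSq r g w
  have hNm : Measurable N := by
    refine measurable_shiftSum (Measurable.pow_const (Measurable.norm ?_) 2)
    exact Finset.measurable_sum _ fun j _ =>
      (Complex.continuous_conj.measurable.comp (hgm j)).mul_const _
  set σN : AddCircle (1 : ℝ) → ℝ := N ∘ divSection r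
  have hσm : Measurable σN := hNm.comp (measurable_divSection r)
  have hσ : ∀ x, σN ((r : ℤ) • x) = N x := fun x =>
    periodic_comp_divSection hr (f := N) (shiftSum_periodic hr _) x
  have hNint : Integrable N haarAddCircle := by
    have h1 : MemLp (fun x => ∑ j, conj (g j x) * w j) ∞ haarAddCircle :=
      memLp_finsetSum _ fun j _ => by
        simp only [mul_comm _ (w j)]
        exact (hg j).star.const_mul (w j)
    exact integrable_shiftSum (h1.mono_exponent (q := ∞) (p := 2) le_top).norm.integrable_sq
  have hσint : Integrable σN haarAddCircle := by
    rw [← hmp.map_eq, integrable_map_measure hσm.aestronglyMeasurable hmp.measurable.aemeasurable]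
    convert hNint using 1
    exact funext hσ
  have key : (fun _ => r * c * ∑ j, ‖w j‖ ^ 2) ≤ᵐ[haarAddCircle] σN := by
    refine ae_le_of_forall_setIntegral_le (integrable_const _) hσint fun B hB _ => ?_
    set ψ : L2Circle := indicatorConstLp 2 hB (measure_ne_top _ _) (1 : ℂ)
    have h1 := h.le_norm_sq_conjMulDilation hr hg w ψ
    have h2 := norm_sq_sum_conjMulDilation hr hg fun j => w j • ψ
    have hψ : ψ =ᵐ[haarAddCircle] B.indicator fun _ => (1 : ℂ) := indicatorConstLp_coeFn
    have h3 : ∫ x, fiberNormSq r g (fun j => (w j • ψ : L2Circle) ((r : ℤ) • x)) x ∂haarAddCircle =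
        ∫ x, B.indicator σN ((r : ℤ) • x) ∂haarAddCircle := by
      refine integral_congr_ae ?_
      have h4 : ∀ᵐ x ∂(haarAddCircle : Measure (AddCircle (1 : ℝ))), ∀ j,
          (w j • ψ : L2Circle) x = w j * B.indicator (fun _ => (1 : ℂ)) x := by
        refine ae_all_iff.2 fun j => ?_
        filter_upwards [hψ, Lp.coeFn_smul (w j) ψ] with x hx1 hx2
        rw [hx2, Pi.smul_apply, hx1, smul_eq_mul]
      filter_upwards [hmp.quasiMeasurePreserving.ae h4] with x hx
      by_cases hxB : (r : ℤ) • x ∈ B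
      · simp only [hx, Set.indicator_of_mem hxB, mul_one, hσ]
        rfl
      · simp only [hx, Set.indicator_of_notMem hxB, mul_zero]
        simp [fiberNormSq, shiftSum]
    have h5 : ‖ψ‖ ^ 2 = haarAddCircle.real B := by
      rw [norm_indicatorConstLp (by norm_num) (by norm_num)]
      rw [norm_one, one_mul, ENNReal.toReal_ofNat, ← Real.sqrt_eq_rpow,
        Real.sq_sqrt measureReal_nonneg]
    rw [h3, integral_comp_zsmul hr (hσm.indicator hB).aestronglyMeasurable,
      integral_indicator hB] at h2
    rw [← h2, setIntegral_const, smul_eq_mul, ← h5]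
    calc ‖ψ‖ ^ 2 * (r * c * ∑ j, ‖w j‖ ^ 2) = r * (c * ((∑ j, ‖w j‖ ^ 2) * ‖ψ‖ ^ 2)) := by ring
      _ ≤ _ := by gcongr
  filter_upwards [hmp.quasiMeasurePreserving.ae key] with x hx
  rwa [hσ] at hx

theorem alphaConst_pos_of_isLowerRieszWith (hgm : ∀ j, Measurable (g j)) {c : ℝ} (hc : 0 < c)
    (h : IsLowerRieszWith c (modulates hr hg)) : 0 < alphaConst r g := by
  rw [alphaConst_pos_iff hr]
  refine ⟨r * c, by positivity, ?_⟩
  -- The exceptional null set depends on w, so w first runs over a countable dense set; both sides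
  -- are continuous in w.
  have h1 := ae_all_iff.2 fun n : ℕ => fiberNormSq_ge_of_isLowerRieszWith hr hg hgm h
    (TopologicalSpace.denseSeq (Fin r → ℂ) n)
  filter_upwards [h1] with x hx
  intro w
  refine (TopologicalSpace.denseRange_denseSeq (Fin r → ℂ)).induction_on
    (p := fun w => r * c * ∑ j, ‖w j‖ ^ 2 ≤ fiberNormSq r g w x) w ?_ hx
  refine isClosed_le (by fun_prop) ?_
  unfold fiberNormSq shiftSum
  fun_prop

end LowerBound

/-- A Riesz basis of a Hilbert space has a biorthogonal Riesz basis. -/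
theorem IsRieszBasis.exists_dual {ι E : Type*} [DecidableEq ι] [NormedAddCommGroup E]
    [InnerProductSpace ℂ E] [CompleteSpace E] {x : ι → E} (h : IsRieszBasis x ⊤) :
    ∃ R : lp (fun _ : ι => ℂ) 2 ≃L[ℂ] E,
      ∀ i k, (inner ℂ (x i) (R (lp.single 2 k (1 : ℂ))) : ℂ) = if i = k then 1 else 0 := by
  obtain ⟨T, hT⟩ := h
  let A : lp (fun _ : ι => ℂ) 2 →L[ℂ] E := (⊤ : Submodule ℂ E).subtypeL ∘L T.toContinuousLinearMap
  let B : E →L[ℂ] lp (fun _ : ι => ℂ) 2 :=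
    T.symm.toContinuousLinearMap ∘L (ContinuousLinearMap.id ℂ E).codRestrict ⊤ fun _ => trivial
  have hBA : ∀ ξ, B (A ξ) = ξ := fun ξ => T.symm_apply_apply ξ
  have hAB : ∀ u, A (B u) = u := fun u => congrArg Subtype.val (T.apply_symm_apply ⟨u, trivial⟩)
  -- With A the synthesis operator and B its inverse, R = B*: indeed ⟨A e_i, B* e_k⟩ = ⟨BA e_i,
  -- e_k⟩.
  refine ⟨ContinuousLinearEquiv.equivOfInverse (ContinuousLinearMap.adjoint B)
    (ContinuousLinearMap.adjoint A) (fun ξ => ?_) (fun u => ?_), fun i k => ?_⟩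
  · refine ext_inner_right ℂ fun η => ?_
    rw [ContinuousLinearMap.adjoint_inner_left, ContinuousLinearMap.adjoint_inner_left, hBA]
  · refine ext_inner_right ℂ fun v => ?_
    rw [ContinuousLinearMap.adjoint_inner_left, ContinuousLinearMap.adjoint_inner_left, hAB]
  · change (inner ℂ (x i) (ContinuousLinearMap.adjoint B (lp.single 2 k (1 : ℂ))) : ℂ) = _
    have h1 : x i = A (lp.single 2 i (1 : ℂ)) := (hT i).symm
    rw [ContinuousLinearMap.adjoint_inner_right, h1, hBA, lp.inner_single_left]
    simp [Pi.single_apply]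

/-! ### The sampling problem in one variable -/

section SingleSpace

variable {H : Type*} [NormedAddCommGroup H] [InnerProductSpace ℂ H]

theorem zpow_zpow_apply (U : H ≃ₗᵢ[ℂ] H) (m n : ℤ) (u : H) :
    (U ^ m) ((U ^ n) u) = (U ^ (m + n)) u := by
  rw [zpow_add]
  rfl

theorem inner_zpow_zpow (U : H ≃ₗᵢ[ℂ] H) (m n : ℤ) (u v : H) :
    (inner ℂ ((U ^ m) u) ((U ^ n) v) : ℂ) = inner ℂ ((U ^ (m - n)) u) v := by
  rw [← (U ^ n).inner_map_map ((U ^ (m - n)) u) v, zpow_zpow_apply, add_sub_cancel]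

/-- The closed linear span of the orbit `Uⁿ a`, `n ∈ ℤ`. -/
def orbitSpace (U : H ≃ₗᵢ[ℂ] H) (a : H) : Submodule ℂ H :=
  (Submodule.span ℂ (Set.range fun n : ℤ => (U ^ n) a)).topologicalClosure

theorem zpow_mem_orbitSpace (U : H ≃ₗᵢ[ℂ] H) {a u : H} (m : ℤ) (hu : u ∈ orbitSpace U a) :
    (U ^ m) u ∈ orbitSpace U a := by
  have h : orbitSpace U a ≤
      (orbitSpace U a).comap ((U ^ m).toLinearIsometry.toLinearMap) := by
    refine Submodule.topologicalClosure_minimal _ (Submodule.span_le.2 ?_)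
      ((Submodule.isClosed_topologicalClosure _).preimage (U ^ m).continuous)
    rintro _ ⟨n, rfl⟩
    change (U ^ m) ((U ^ n) a) ∈ orbitSpace U a
    rw [zpow_zpow_apply]
    exact Submodule.le_topologicalClosure _ (Submodule.subset_span ⟨m + n, rfl⟩)
  exact h hu

theorem exists_equiv_orbitSpace (U : H ≃ₗᵢ[ℂ] H) (a : H)
    (ha : IsRieszSequence fun n : ℤ => (U ^ n) a) :
    ∃ Q : L2Circle ≃L[ℂ] orbitSpace U a, ∀ n : ℤ, (Q (fourierLp 2 n) : H) = (U ^ n) a := by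
  have ha' : IsRieszBasis (fun n : ℤ => (U ^ n) a) (orbitSpace U a) := ha
  obtain ⟨T, hT⟩ := ha'
  refine ⟨(fourierBasis (T := (1 : ℝ))).repr.toContinuousLinearEquiv.trans T, fun n => ?_⟩
  have h : (fourierBasis (T := (1 : ℝ))).repr (fourierLp 2 n) = lp.single 2 n (1 : ℂ) := by
    rw [← coe_fourierBasis, HilbertBasis.repr_self]
  refine Eq.trans ?_ (hT n)
  rw [← h]
  rfl

theorem inner_fourierLp_genFun [CompleteSpace H] (U : H ≃ₗᵢ[ℂ] H) (a h : H)
    (ha : IsRieszSequence fun n : ℤ => (U ^ n) a) (m : ℤ) :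
    (inner ℂ (fourierLp 2 m : L2Circle) (genFun U a h) : ℂ) = inner ℂ ((U ^ m) h) a := by
  have h1 := (hasSum_genFun U a h ha).mapL (innerSL ℂ (fourierLp 2 m : L2Circle))
  simp only [innerSL_apply_apply, inner_smul_right,
    orthonormal_iff_ite.1 (orthonormal_fourier (T := (1 : ℝ))), mul_ite, mul_one, mul_zero] at h1
  refine h1.unique ?_
  simpa using hasSum_single (f := fun k => if m = k then (inner ℂ ((U ^ k) h) a : ℂ) else 0) m
    fun k hk => by simp [hk.symm]

variable (U : H ≃ₗᵢ[ℂ] H) (a : H) {r : ℕ} (hr : 0 < r) (h : Fin r → H)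
  (hg : ∀ j, MemLp (genFun U a (h j)) ∞ haarAddCircle)

theorem inner_modulates_fourierLp (j : Fin r) (n k : ℤ) :
    (inner ℂ (modulates hr hg (j, n)) (fourierLp 2 k : L2Circle) : ℂ) =
      inner ℂ (fourierLp 2 ((r : ℤ) * n - k) : L2Circle) (genFun U a (h j)) := by
  rw [L2.inner_def, L2.inner_def]
  refine integral_congr_ae ?_
  filter_upwards [coeFn_conjMulDilation hr (hg j) (fourierLp 2 n),
    (measurePreserving_mul hr).quasiMeasurePreserving.ae (coeFn_fourierLp (T := 1) 2 n),
    coeFn_fourierLp (T := 1) 2 k, coeFn_fourierLp (T := 1) 2 ((r : ℤ) * n - k)] with x h1 h2 h3 h4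
  have h5 : modulates hr hg (j, n) x = conj (genFun U a (h j) x) * fourier n ((r : ℤ) • x) := by
    rw [← h2]
    exact h1
  have h6 : (fourier n ((r : ℤ) • x) : ℂ) = fourier ((r : ℤ) * n) x := by
    rw [fourier_apply, fourier_apply, smul_smul, mul_comm]
  rw [h3, h4, h5, h6, sub_eq_add_neg, fourier_add, fourier_neg]
  simp only [RCLike.inner_apply, map_mul, Complex.conj_conj]
  ring

/-- On F = e^{2πikx} both sides equal the Fourier coefficient of g_j at rn − k; exponentials span a
dense subspace and both sides are continuous in F. -/
theorem inner_zpow_equiv_eq [CompleteSpace H] {Q : L2Circle ≃L[ℂ] orbitSpace U a}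
    (hQ : ∀ n : ℤ, (Q (fourierLp 2 n) : H) = (U ^ n) a)
    (ha : IsRieszSequence fun n : ℤ => (U ^ n) a) (i : Fin r × ℤ) (F : L2Circle) :
    (inner ℂ ((U ^ ((r : ℤ) * i.2)) (h i.1)) (Q F : H) : ℂ) =
      inner ℂ (modulates hr hg i) F := by
  have key : (innerSL ℂ ((U ^ ((r : ℤ) * i.2)) (h i.1))) ∘L
      ((orbitSpace U a).subtypeL ∘L Q.toContinuousLinearMap) = innerSL ℂ (modulates hr hg i) := by
    refine ContinuousLinearMap.ext_on (s := Set.range (fourierLp (T := (1 : ℝ)) 2)) ?_ ?_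
    · rw [Submodule.dense_iff_topologicalClosure_eq_top]
      exact span_fourierLp_closure_eq_top (by norm_num)
    · rintro _ ⟨k, rfl⟩
      change (inner ℂ ((U ^ ((r : ℤ) * i.2)) (h i.1)) (Q (fourierLp 2 k) : H) : ℂ) =
        inner ℂ (modulates hr hg (i.1, i.2)) (fourierLp 2 k : L2Circle)
      rw [inner_modulates_fourierLp, inner_fourierLp_genFun U a _ ha, hQ, inner_zpow_zpow]
  exact DFunLike.congr_fun key F

/-- If `α_G > 0`, then the orthogonal projections of the vectors `U^{rn} h_j` have a dual Riesz
basis, which is again generated by `r` vectors. -/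
theorem exists_dual_of_alphaConst_pos [CompleteSpace H] (U : H ≃ₗᵢ[ℂ] H) (a : H)
    (ha : IsRieszSequence fun n : ℤ => (U ^ n) a) {r : ℕ} (hr : 0 < r) (h : Fin r → H)
    (hg : ∀ j, MemLp (genFun U a (h j)) ∞ haarAddCircle)
    (hpos : 0 < alphaConst r fun j => genFun U a (h j)) :
    ∃ c : Fin r → H, (∀ j, c j ∈ orbitSpace U a) ∧
      IsRieszBasis (fun i : Fin r × ℤ => (U ^ ((r : ℤ) * i.2)) (c i.1)) (orbitSpace U a) ∧
      ∀ i k : Fin r × ℤ, (inner ℂ ((U ^ ((r : ℤ) * i.2)) (h i.1))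
        ((U ^ ((r : ℤ) * k.2)) (c k.1)) : ℂ) = if i = k then 1 else 0 := by
  have hgm : ∀ j, Measurable (genFun U a (h j)) := fun j =>
    (Lp.stronglyMeasurable (genFun U a (h j))).measurable
  have hr0 : (0 : ℝ) < r := by positivity
  obtain ⟨Q, hQ⟩ := exists_equiv_orbitSpace U a ha
  obtain ⟨c₀, hc₀, hc⟩ := (alphaConst_pos_iff hr _).1 hpos
  have hR : IsRieszSequence (modulates hr hg) := isRieszSequence_of_bounds (div_pos hc₀ hr0)
    (isLowerRieszWith_modulates hr hg hc) (isBesselWith_modulates hr hg)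
  rw [IsRieszSequence, closure_span_modulates hr hgm hg hc₀ hc] at hR
  obtain ⟨R, hR⟩ := hR.exists_dual
  set x : Fin r × ℤ → H := fun i => (Q (R (lp.single 2 i (1 : ℂ))) : H) with hx
  have hxA : ∀ i, x i ∈ orbitSpace U a := fun i => (Q _).2
  have hxR : IsRieszBasis x (orbitSpace U a) := ⟨R.trans Q, fun i => rfl⟩
  have hdual : ∀ i k, (inner ℂ ((U ^ ((r : ℤ) * i.2)) (h i.1)) (x k) : ℂ) =
      if i = k then 1 else 0 := fun i k => by
    rw [hx, inner_zpow_equiv_eq U a hr h hg hQ ha, hR]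
  -- The shifted vector has the same samples as x_i, namely δ, so its expansion in the basis x
  -- reduces to the single term x_i.
  have hshift : ∀ i : Fin r × ℤ, (U ^ ((r : ℤ) * i.2)) (x (i.1, 0)) = x i := by
    intro i
    have h1 := hxR.hasSum_inner hdual (zpow_mem_orbitSpace U ((r : ℤ) * i.2) (hxA (i.1, 0)))
    have h2 : ∀ k : Fin r × ℤ, (inner ℂ ((U ^ ((r : ℤ) * k.2)) (h k.1))
        ((U ^ ((r : ℤ) * i.2)) (x (i.1, 0))) : ℂ) = if k = i then 1 else 0 := by
      intro k
      rw [inner_zpow_zpow, ← mul_sub, hdual (k.1, k.2 - i.2)]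
      simp only [Prod.ext_iff, sub_eq_zero]
    simp only [h2, ite_smul, one_smul, zero_smul] at h1
    refine h1.unique ?_
    simpa using hasSum_single (f := fun k => if k = i then x k else 0) i
      fun k hk => by simp [hk]
  refine ⟨fun j => x (j, 0), fun j => hxA _, ?_, fun i k => ?_⟩
  · simpa only [hshift] using hxR
  · simp only [hshift]
    exact hdual i k

/-- If `r` vectors of the orbit space generate a Bessel family biorthogonal to `U^{rn} h_j`,
then `α_G > 0`. -/
theorem alphaConst_pos_of_biorthogonal [CompleteSpace H] (U : H ≃ₗᵢ[ℂ] H) (a : H)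
    (ha : IsRieszSequence fun n : ℤ => (U ^ n) a) {r : ℕ} (hr : 0 < r) (h : Fin r → H)
    (hg : ∀ j, MemLp (genFun U a (h j)) ∞ haarAddCircle) {c : Fin r → H}
    (hc : ∀ j, c j ∈ orbitSpace U a) {D : ℝ}
    (hD : IsBesselWith D fun i : Fin r × ℤ => (U ^ ((r : ℤ) * i.2)) (c i.1))
    (hdual : ∀ (j k : Fin r) (n : ℤ), (inner ℂ ((U ^ ((r : ℤ) * n)) (h k)) (c j) : ℂ) =
      if j = k ∧ n = 0 then 1 else 0) :
    0 < alphaConst r fun j => genFun U a (h j) := by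
  have hgm : ∀ j, Measurable (genFun U a (h j)) := fun j =>
    (Lp.stronglyMeasurable (genFun U a (h j))).measurable
  obtain ⟨Q, hQ⟩ := exists_equiv_orbitSpace U a ha
  have hD := hD.mono (le_max_left D 1)
  set D' := max D 1
  have hD0 : 0 < D' := lt_of_lt_of_le one_pos (le_max_right _ _)
  set K : ℝ := ‖(Q.symm : orbitSpace U a →L[ℂ] L2Circle)‖ ^ 2 + 1
  have hK : 0 < K := by positivity
  -- The constant comes from ‖F‖² ≤ K D' S below, where F pulls back ∑ α_i U^{rn}c_j and S = ∑
  -- |α_i|². Biorthogonality gives S = ⟨∑ α_i m_i, F⟩ with m_i the modulated functions, and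
  -- Cauchy–Schwarz then bounds S² by K D' S ‖∑ α_i m_i‖².
  refine alphaConst_pos_of_isLowerRieszWith hr hg hgm (c := (K * D')⁻¹) (by positivity)
    fun s α => ?_
  set S : ℝ := ∑ i ∈ s, ‖α i‖ ^ 2
  have hS0 : 0 ≤ S := Finset.sum_nonneg fun _ _ => sq_nonneg _
  set u : orbitSpace U a := ⟨∑ i ∈ s, α i • (U ^ ((r : ℤ) * i.2)) (c i.1),
    Submodule.sum_mem _ fun i _ => Submodule.smul_mem _ _ (zpow_mem_orbitSpace U _ (hc i.1))⟩
  set F : L2Circle := Q.symm u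
  have hF : ‖F‖ ^ 2 ≤ K * (D' * S) := by
    have h1 : ‖F‖ ≤ ‖(Q.symm : orbitSpace U a →L[ℂ] L2Circle)‖ * ‖u‖ :=
      (Q.symm : orbitSpace U a →L[ℂ] L2Circle).le_opNorm u
    have h2 : ‖u‖ ^ 2 ≤ D' * S := hD s α
    calc ‖F‖ ^ 2 ≤ (‖(Q.symm : orbitSpace U a →L[ℂ] L2Circle)‖ * ‖u‖) ^ 2 := by gcongr
      _ = ‖(Q.symm : orbitSpace U a →L[ℂ] L2Circle)‖ ^ 2 * ‖u‖ ^ 2 := mul_pow _ _ _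
      _ ≤ K * (D' * S) := by
        gcongr
        exact le_add_of_nonneg_right zero_le_one
  have hθ : ∀ i ∈ s, (inner ℂ (modulates hr hg i) F : ℂ) = α i := by
    intro i hi
    rw [← inner_zpow_equiv_eq U a hr h hg hQ ha]
    simp only [F, ContinuousLinearEquiv.apply_symm_apply, u, inner_sum, inner_smul_right]
    rw [Finset.sum_eq_single i]
    · rw [inner_zpow_zpow, ← mul_sub, hdual]
      simp
    · intro k _ hk
      rw [inner_zpow_zpow, ← mul_sub, hdual, if_neg, mul_zero]
      rintro ⟨h1, h2⟩
      exact hk (Prod.ext h1 (sub_eq_zero.1 h2).symm)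
    · exact fun h => absurd hi h
  have hSF : (S : ℂ) = inner ℂ (∑ i ∈ s, α i • modulates hr hg i) F := by
    simp only [sum_inner, inner_smul_left, S, Complex.ofReal_sum, Complex.ofReal_pow]
    exact Finset.sum_congr rfl fun i hi => by rw [hθ i hi, Complex.conj_mul']
  have hle : S ≤ ‖∑ i ∈ s, α i • modulates hr hg i‖ * ‖F‖ := by
    have := norm_inner_le_norm (𝕜 := ℂ) (∑ i ∈ s, α i • modulates hr hg i) F
    rwa [← hSF, Complex.norm_real, Real.norm_of_nonneg hS0] at this
  set Z := ‖∑ i ∈ s, α i • modulates hr hg i‖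
  rw [inv_mul_le_iff₀ (by positivity)]
  rcases hS0.eq_or_lt with h0 | h0
  · rw [← h0]
    positivity
  · refine le_of_mul_le_mul_right ?_ h0
    calc S * S ≤ (Z * ‖F‖) * (Z * ‖F‖) := mul_self_le_mul_self hS0 hle
      _ = Z ^ 2 * ‖F‖ ^ 2 := by ring
      _ ≤ Z ^ 2 * (K * (D' * S)) := by gcongr
      _ = K * D' * Z ^ 2 * S := by ring

end SingleSpace

/-! ### Sampling in the tensor product -/

section Sampling

variable {H₁ H₂ : Type*} [NormedAddCommGroup H₁] [InnerProductSpace ℂ H₁]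
  [NormedAddCommGroup H₂] [InnerProductSpace ℂ H₂]

theorem norm_tens (u : H₁) (v : H₂) : ‖tens u v‖ = ‖u‖ * ‖v‖ := by
  simp [tens]

theorem sample_tens (U : H₁ ≃ₗᵢ[ℂ] H₁) (V : H₂ ≃ₗᵢ[ℂ] H₂) (h₁ u : H₁) (h₂ v : H₂) (k l : ℤ) :
    sample U V h₁ h₂ (tens u v) k l = inner ℂ ((U ^ k) h₁) u * inner ℂ ((V ^ l) h₂) v :=
  inner_tens _ _ _ _

theorem tensOp_zpow_zero (U : H₁ ≃ₗᵢ[ℂ] H₁) (V : H₂ ≃ₗᵢ[ℂ] H₂) (u : H₁) (v : H₂) :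
    tensOp (U ^ (0 : ℤ)) (V ^ (0 : ℤ)) (tens u v) = tens u v := by
  rw [tensOp_tens]
  rfl

/-- For z orthogonal to the orbit of a, z ⊗ v is orthogonal to the whole shift space, so ⟨z, u⟩‖v‖²
= 0. -/
theorem mem_orbitSpace_left [CompleteSpace H₁] {U : H₁ ≃ₗᵢ[ℂ] H₁} {V : H₂ ≃ₗᵢ[ℂ] H₂} {a : H₁}
    {b : H₂} {u : H₁} {v : H₂} (h : tens u v ∈ shiftSpace U V a b) (hv : v ≠ 0) :
    u ∈ orbitSpace U a := by
  rw [orbitSpace, ← Submodule.orthogonal_orthogonal_eq_closure, Submodule.mem_orthogonal]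
  intro z hz
  have h1 : shiftSpace U V a b ≤ LinearMap.ker (innerSL ℂ (tens z v)).toLinearMap := by
    refine Submodule.topologicalClosure_minimal _ (Submodule.span_le.2 ?_)
      (ContinuousLinearMap.isClosed_ker _)
    rintro _ ⟨p, rfl⟩
    change (inner ℂ (tens z v) (tens ((U ^ p.1) a) ((V ^ p.2) b)) : ℂ) = 0
    rw [inner_tens, (Submodule.mem_orthogonal' _ z).1 hz _ (Submodule.subset_span ⟨p.1, rfl⟩),
      zero_mul]
  have h2 : (inner ℂ (tens z v) (tens u v) : ℂ) = 0 := h1 h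
  rw [inner_tens] at h2
  exact (mul_eq_zero.1 h2).resolve_right (inner_self_ne_zero.2 hv)

theorem mem_orbitSpace_right [CompleteSpace H₂] {U : H₁ ≃ₗᵢ[ℂ] H₁} {V : H₂ ≃ₗᵢ[ℂ] H₂} {a : H₁}
    {b : H₂} {u : H₁} {v : H₂} (h : tens u v ∈ shiftSpace U V a b) (hu : u ≠ 0) :
    v ∈ orbitSpace V b := by
  rw [orbitSpace, ← Submodule.orthogonal_orthogonal_eq_closure, Submodule.mem_orthogonal]
  intro z hz
  have h1 : shiftSpace U V a b ≤ LinearMap.ker (innerSL ℂ (tens u z)).toLinearMap := by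
    refine Submodule.topologicalClosure_minimal _ (Submodule.span_le.2 ?_)
      (ContinuousLinearMap.isClosed_ker _)
    rintro _ ⟨p, rfl⟩
    change (inner ℂ (tens u z) (tens ((U ^ p.1) a) ((V ^ p.2) b)) : ℂ) = 0
    rw [inner_tens, (Submodule.mem_orthogonal' _ z).1 hz _ (Submodule.subset_span ⟨p.2, rfl⟩),
      mul_zero]
  have h2 : (inner ℂ (tens u z) (tens u v) : ℂ) = 0 := h1 h
  rw [inner_tens] at h2
  exact (mul_eq_zero.1 h2).resolve_left (inner_self_ne_zero.2 hu)

variable {U : H₁ ≃ₗᵢ[ℂ] H₁} {V : H₂ ≃ₗᵢ[ℂ] H₂} {a : H₁} {b : H₂} {r r' : ℕ}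
  {h₁ : Fin r → H₁} {h₂ : Fin r' → H₂}

theorem IsRieszSampling.tensOp_zero {C : Fin r → Fin r' → HTensor H₁ H₂}
    (hC : IsRieszSampling U V a b r r' h₁ h₂ C) (j : Fin r) (j' : Fin r') :
    tensOp (U ^ ((r : ℤ) * 0)) (V ^ ((r' : ℤ) * 0)) (C j j') = C j j' := by
  obtain ⟨c, d, hcd⟩ := hC.elementary
  rw [hcd, mul_zero, mul_zero, tensOp_zpow_zero]

/-- `C j j'` is itself the basis vector with n = m = 0, so its sampling expansion must be the
trivial one. -/
theorem IsRieszSampling.interpolation {C : Fin r → Fin r' → HTensor H₁ H₂}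
    (hC : IsRieszSampling U V a b r r' h₁ h₂ C) (j k : Fin r) (j' k' : Fin r') (n m : ℤ) :
    sample U V (h₁ k) (h₂ k') (C j j') ((r : ℤ) * n) ((r' : ℤ) * m) =
      if j = k ∧ j' = k' ∧ n = 0 ∧ m = 0 then 1 else 0 := by
  have h1 := hC.expansion (C j j') (hC.mem j j')
  have h2 := hC.rieszBasis.coeff_unique (k := ((j, j'), (0, 0)))
    (α := fun i => sample U V (h₁ i.1.1) (h₂ i.1.2) (C j j') ((r : ℤ) * i.2.1) ((r' : ℤ) * i.2.2))
    (by simpa only [hC.tensOp_zero] using h1) ((k, k'), (n, m))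
  refine h2.trans ?_
  simp only [Prod.mk.injEq, and_assoc, eq_comm (a := j), eq_comm (a := j')]

/-- Expanding `C' j j'` along the basis of C, the coefficients are δ by the interpolation property
of C', leaving `C j j'`. -/
theorem IsRieszSampling.unique {C C' : Fin r → Fin r' → HTensor H₁ H₂}
    (hC : IsRieszSampling U V a b r r' h₁ h₂ C) (hC' : IsRieszSampling U V a b r r' h₁ h₂ C') :
    C' = C := by
  funext j j'
  have h1 := hC.expansion (C' j j') (hC'.mem j j')
  simp only [hC'.interpolation] at h1
  refine h1.unique ?_
  convert hasSum_single (((j, j'), (0, 0)) : (Fin r × Fin r') × (ℤ × ℤ)) ?_ using 1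
  · simp only [and_self, if_true, one_smul]
    exact (hC.tensOp_zero j j').symm
  · rintro ⟨⟨k, k'⟩, ⟨n, m⟩⟩ hi
    rw [if_neg, zero_smul]
    rintro ⟨rfl, rfl, rfl, rfl⟩
    exact hi rfl

theorem exists_isRieszSampling [CompleteSpace H₁] [CompleteSpace H₂]
    (ha : IsRieszSequence fun n : ℤ => (U ^ n) a) (hb : IsRieszSequence fun m : ℤ => (V ^ m) b)
    (hr : 0 < r) (hr' : 0 < r')
    (hg₁ : ∀ j, MemLp (genFun U a (h₁ j)) ∞ haarAddCircle)
    (hg₂ : ∀ j', MemLp (genFun V b (h₂ j')) ∞ haarAddCircle)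
    (hα₁ : 0 < alphaConst r fun j => genFun U a (h₁ j))
    (hα₂ : 0 < alphaConst r' fun j' => genFun V b (h₂ j')) :
    ∃ C, IsRieszSampling U V a b r r' h₁ h₂ C := by
  obtain ⟨c, hcA, hcR, hcd⟩ := exists_dual_of_alphaConst_pos U a ha hr h₁ hg₁ hα₁
  obtain ⟨d, hdA, hdR, hdd⟩ := exists_dual_of_alphaConst_pos V b hb hr' h₂ hg₂ hα₂
  have hR : IsRieszBasis (fun i : (Fin r × Fin r') × (ℤ × ℤ) =>
      tensOp (U ^ ((r : ℤ) * i.2.1)) (V ^ ((r' : ℤ) * i.2.2)) (tens (c i.1.1) (d i.1.2)))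
      (shiftSpace U V a b) := by
    simp only [tensOp_tens]
    -- The tensor basis is indexed by ((j, n), (j', m)), the sampling family by ((j, j'), (n, m)).
    exact (IsRieszBasis.tens hcR hdR).reindex (Equiv.prodProdProdComm (Fin r) (Fin r') ℤ ℤ)
  refine ⟨fun j j' => tens (c j) (d j'), ⟨c, d, fun _ _ => rfl⟩, fun j j' => ?_, hR, ?_⟩
  · exact tens_mem_of_mem_closure (Submodule.isClosed_topologicalClosure _)
      (fun n m => Submodule.le_topologicalClosure (Submodule.span ℂ (Set.range
        fun p : ℤ × ℤ => tens ((U ^ p.1) a) ((V ^ p.2) b)))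
        (Submodule.subset_span ⟨(n, m), rfl⟩)) (hcA j) (hdA j')
  · intro x hx
    refine hR.hasSum_inner (y := fun i : (Fin r × Fin r') × (ℤ × ℤ) =>
      tens ((U ^ ((r : ℤ) * i.2.1)) (h₁ i.1.1)) ((V ^ ((r' : ℤ) * i.2.2)) (h₂ i.1.2)))
      (fun i k => ?_) hx
    rw [tensOp_tens, inner_tens, hcd (i.1.1, i.2.1) (k.1.1, k.2.1),
      hdd (i.1.2, i.2.2) (k.1.2, k.2.2), ite_zero_mul_ite_zero, one_mul]
    refine if_congr ?_ rfl rfl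
    simp only [Prod.ext_iff]
    tauto

theorem IsRieszSampling.alphaConst_left_pos [CompleteSpace H₁] {C : Fin r → Fin r' → HTensor H₁ H₂}
    (hC : IsRieszSampling U V a b r r' h₁ h₂ C)
    (ha : IsRieszSequence fun n : ℤ => (U ^ n) a) (hr : 0 < r) (hr' : 0 < r')
    (hg₁ : ∀ j, MemLp (genFun U a (h₁ j)) ∞ haarAddCircle) :
    0 < alphaConst r fun j => genFun U a (h₁ j) := by
  obtain ⟨c, d, hcd⟩ := hC.elementary
  let o : Fin r := ⟨0, hr⟩
  let o' : Fin r' := ⟨0, hr'⟩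
  have hint : ∀ (j k : Fin r) (n : ℤ), (inner ℂ ((U ^ ((r : ℤ) * n)) (h₁ k)) (c j) : ℂ) *
      inner ℂ (h₂ o') (d o') = if j = k ∧ n = 0 then 1 else 0 := by
    intro j k n
    have h1 := hC.interpolation j k o' o' n 0
    rw [hcd, sample_tens, mul_zero, zpow_zero] at h1
    simpa using h1
  -- Freezing the second index at o' and m = 0 leaves biorthogonality of the c_j up to the factor β,
  -- which is nonzero because a product containing it equals 1. Hence the vectors β c_j are used
  -- below.
  set β : ℂ := inner ℂ (h₂ o') (d o') with hβ
  have hβ0 : β ≠ 0 := fun h0 => by simpa [h0] using hint o o 0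
  have hd0 : d o' ≠ 0 := fun h0 => hβ0 (by rw [hβ, h0, inner_zero_right])
  obtain ⟨D, -, hD⟩ := hC.rieszBasis.isBesselWith
  have hdn : 0 < ‖d o'‖ ^ 2 := by positivity
  -- The Bessel bound is that of the subfamily with second index o' and m = 0: tensoring with d_{o'}
  -- multiplies norms by ‖d_{o'}‖, and β enters through the coefficients.
  refine alphaConst_pos_of_biorthogonal U a ha hr h₁ hg₁ (c := fun j => β • c j)
    (D := D * ‖β‖ ^ 2 / ‖d o'‖ ^ 2) (fun j => Submodule.smul_mem _ _ ?_) (fun s α => ?_)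
    fun j k n => ?_
  · exact mem_orbitSpace_left (hcd j o' ▸ hC.mem j o') hd0
  · let e : Fin r × ℤ ↪ (Fin r × Fin r') × (ℤ × ℤ) :=
      ⟨fun i => ((i.1, o'), (i.2, 0)), fun i k h => by
        simp only [Prod.mk.injEq] at h
        exact Prod.ext h.1.1 h.2.1⟩
    have h1 := hD (s.map e) fun i => β * α (i.1.1, i.2.1)
    simp only [Finset.sum_map, e, norm_mul, mul_pow,
      ← Finset.mul_sum, hcd, tensOp_tens] at h1
    have h2 : ∑ i ∈ s, (β * α i) • tens ((U ^ ((r : ℤ) * i.2)) (c i.1)) (d o') =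
        tens (∑ i ∈ s, α i • (U ^ ((r : ℤ) * i.2)) (β • c i.1)) (d o') := by
      simp only [← tensL_apply, map_sum, map_smul, sum_apply,
        smul_apply, smul_smul, mul_comm β]
    change ‖∑ i ∈ s, (β * α i) • tens ((U ^ ((r : ℤ) * i.2)) (c i.1)) (d o')‖ ^ 2 ≤ _ at h1
    rw [h2, norm_tens, mul_pow] at h1
    rw [div_mul_eq_mul_div, le_div_iff₀ hdn, mul_assoc D]
    exact h1
  · rw [inner_smul_right, mul_comm]
    exact hint j k n

theorem IsRieszSampling.alphaConst_right_pos [CompleteSpace H₂] {C : Fin r → Fin r' → HTensor H₁ H₂}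
    (hC : IsRieszSampling U V a b r r' h₁ h₂ C)
    (hb : IsRieszSequence fun n : ℤ => (V ^ n) b) (hr : 0 < r) (hr' : 0 < r')
    (hg₂ : ∀ j, MemLp (genFun V b (h₂ j)) ∞ haarAddCircle) :
    0 < alphaConst r' fun j => genFun V b (h₂ j) := by
  obtain ⟨c, d, hcd⟩ := hC.elementary
  let o : Fin r := ⟨0, hr⟩
  let o' : Fin r' := ⟨0, hr'⟩
  have hint : ∀ (j k : Fin r') (n : ℤ), (inner ℂ (h₁ o) (c o) : ℂ) *
      inner ℂ ((V ^ ((r' : ℤ) * n)) (h₂ k)) (d j) = if j = k ∧ n = 0 then 1 else 0 := by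
    intro j k n
    have h1 := hC.interpolation o o j k 0 n
    rw [hcd, sample_tens, mul_zero, zpow_zero] at h1
    simpa using h1
  set β : ℂ := inner ℂ (h₁ o) (c o) with hβ
  have hβ0 : β ≠ 0 := fun h0 => by simpa [h0] using hint o' o' 0
  have hc0 : c o ≠ 0 := fun h0 => hβ0 (by rw [hβ, h0, inner_zero_right])
  obtain ⟨D, -, hD⟩ := hC.rieszBasis.isBesselWith
  have hcn : 0 < ‖c o‖ ^ 2 := by positivity
  refine alphaConst_pos_of_biorthogonal V b hb hr' h₂ hg₂ (c := fun j => β • d j)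
    (D := D * ‖β‖ ^ 2 / ‖c o‖ ^ 2) (fun j => Submodule.smul_mem _ _ ?_) (fun s α => ?_)
    fun j k n => ?_
  · exact mem_orbitSpace_right (hcd o j ▸ hC.mem o j) hc0
  · let e : Fin r' × ℤ ↪ (Fin r × Fin r') × (ℤ × ℤ) :=
      ⟨fun i => ((o, i.1), (0, i.2)), fun i k h => by
        simp only [Prod.mk.injEq] at h
        exact Prod.ext h.1.2 h.2.2⟩
    have h1 := hD (s.map e) fun i => β * α (i.1.2, i.2.2)
    simp only [Finset.sum_map, e, norm_mul, mul_pow,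
      ← Finset.mul_sum, hcd, tensOp_tens] at h1
    have h2 : ∑ i ∈ s, (β * α i) • tens (c o) ((V ^ ((r' : ℤ) * i.2)) (d i.1)) =
        tens (c o) (∑ i ∈ s, α i • (V ^ ((r' : ℤ) * i.2)) (β • d i.1)) := by
      simp only [← tensL_apply, map_sum, map_smul, smul_smul, mul_comm β]
    change ‖∑ i ∈ s, (β * α i) • tens (c o) ((V ^ ((r' : ℤ) * i.2)) (d i.1))‖ ^ 2 ≤ _ at h1
    rw [h2, norm_tens, mul_pow, mul_comm (‖c o‖ ^ 2)] at h1
    rw [div_mul_eq_mul_div, le_div_iff₀ hcn, mul_assoc D]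
    exact h1
  · rw [inner_smul_right]
    exact hint j k n

end Sampling

end UVSampling

end

theorem mainTheorem4 {H₁ H₂ : Type*}
    [NormedAddCommGroup H₁] [InnerProductSpace ℂ H₁] [CompleteSpace H₁]
    [TopologicalSpace.SeparableSpace H₁]
    [NormedAddCommGroup H₂] [InnerProductSpace ℂ H₂] [CompleteSpace H₂]
    [TopologicalSpace.SeparableSpace H₂]
    (U : H₁ ≃ₗᵢ[ℂ] H₁) (V : H₂ ≃ₗᵢ[ℂ] H₂) (a : H₁) (b : H₂)
    (ha : IsRieszSequence fun n : ℤ => (U ^ n) a)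
    (hb : IsRieszSequence fun m : ℤ => (V ^ m) b)
    (r r' : ℕ) (hr : 0 < r) (hr' : 0 < r')
    (h₁ : Fin r → H₁) (h₂ : Fin r' → H₂)
    (hg₁ : ∀ j, MemLp (genFun U a (h₁ j)) ∞ haarAddCircle)
    (hg₂ : ∀ j', MemLp (genFun V b (h₂ j')) ∞ haarAddCircle) :
    ((0 < alphaConst r (fun j => genFun U a (h₁ j)) ∧
        0 < alphaConst r' (fun j' => genFun V b (h₂ j'))) ↔
      ∃! C : Fin r → Fin r' → HTensor H₁ H₂, IsRieszSampling U V a b r r' h₁ h₂ C) ∧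
    ∀ C : Fin r → Fin r' → HTensor H₁ H₂, IsRieszSampling U V a b r r' h₁ h₂ C →
      ∀ (j k : Fin r) (j' k' : Fin r') (n m : ℤ),
        sample U V (h₁ k) (h₂ k') (C j j') ((r : ℤ) * n) ((r' : ℤ) * m) =
          if j = k ∧ j' = k' ∧ n = 0 ∧ m = 0 then 1 else 0 := by
  refine ⟨⟨fun h => ?_, fun ⟨C, hC, _⟩ => ?_⟩, fun C hC => hC.interpolation⟩
  · obtain ⟨C, hC⟩ := exists_isRieszSampling ha hb hr hr' hg₁ hg₂ h.1 h.2
    exact ⟨C, hC, fun C' hC' => hC.unique hC'⟩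
  · exact ⟨hC.alphaConst_left_pos ha hr hr' hg₁, hC.alphaConst_right_pos hb hr hr' hg₂⟩
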